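/- All graphs are finite and simple. A total coloring of a graph $G$ assigns a color to every vertex and every edge of $G$ so that adjacent vertices receive different colors, adjacent edges receive different colors, and every edge receives a color different from those of its two endpoints; the total chromatic number $\chi_T(G)$ is the least number of colors in a total coloring of $G$. Let $\Delta(G)$ denote the maximum degree of $G$ (with $\Delta(G)=0$ if $G$ has no vertices). Theorem 1. Every graph $G$ satisfies $$\chi_T(G)\le \Delta(G)+2\left\lceil\frac{|V(G)|}{\Delta(G)+1}\right\rceil .$$ If $\Delta(G)\ge 1$, this bound is smaller by at least one than Hind's bound $\Delta(G)+2\left\lceil\frac{|V(G)|}{\Delta(G)}\right\rceil+1$, that is, $$\Delta(G)+2\left\lceil\frac{|V(G)|}{\Delta(G)+1}\right\rceil+1\le \Delta(G)+2\left\lceil\frac{|V(G)|}{\Delta(G)}\right\rceil+1 .$$ In particular, if $\Delta(G)\ge \frac12|V(G)|$, then $G$ has a total coloring using at most $\Delta(G)+4$ colors. -/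

import Mathlib

namespace SimpleGraph

/-- A total coloring of `G` with colors in `α`: an assignment of colors to the vertices and the
edges of `G` such that adjacent vertices, adjacent edges (two distinct edges with a common
endpoint), and incident vertex-edge pairs receive different colors. -/
structure IsTotalColoring {V α : Type*} (G : SimpleGraph V) (c : V ⊕ G.edgeSet → α) : Prop where
  vertex_ne : ∀ u v : V, G.Adj u v → c (Sum.inl u) ≠ c (Sum.inl v)
  edge_ne : ∀ e f : G.edgeSet, e ≠ f → (∃ v : V, v ∈ (e : Sym2 V) ∧ v ∈ (f : Sym2 V)) →
    c (Sum.inr e) ≠ c (Sum.inr f)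
  incident_ne : ∀ (v : V) (e : G.edgeSet), v ∈ (e : Sym2 V) → c (Sum.inl v) ≠ c (Sum.inr e)

/-- `G` has a total coloring that uses at most `k` colors. -/
def TotalColorable {V : Type*} (G : SimpleGraph V) (k : ℕ) : Prop :=
  ∃ c : V ⊕ G.edgeSet → Fin k, G.IsTotalColoring c

/-- The total chromatic number: the minimum number of colors in a total coloring of `G`
(`⊤` if finitely many colors do not suffice, which does not happen for finite graphs). -/
noncomputable def totalChromaticNumber {V : Type*} (G : SimpleGraph V) : ℕ∞ :=
  ⨅ k ∈ {k : ℕ | G.TotalColorable k}, (k : ℕ∞)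

end SimpleGraph

/-!
Let `Δ` be the maximum degree and `r = ⌈|V| / (Δ + 1)⌉`. By the Hajnal–Szemerédi theorem, whose
proof by Kierstead and Kostochka is followed here, the vertices can be colored with `Δ + 1` colors,
each used at most `r` times. Vizing's argument extends this coloring to the edges with `Δ + 2 r`
colors in total, at least one of which, `β`, is not used on vertices. Take a partial extension with
as many colored edges as possible and suppose that the edge `xy` is uncolored. Double counting
yields a color `α` that is missing at more than `r + 1` vertices of the fan at `x` that starts with
`xy`. The paths of colors `α` and `β` from all these vertices must end in vertices of color `α`, of
which there are at most `r`, except for one that may reach a neighbor of `x`: otherwise swapping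
the colors along such a path and shifting the fan would color one more edge. An unused color `β`
exists only if `r ≥ 2`; for `r = 1`, an edge coloring of the complete graph on `|V| + 1` vertices
gives a total coloring directly.
-/

namespace TotalColoring

open Finset Relation SimpleGraph
open scoped Classical

section SimpleChain

/-- `SimpleChain R a T b`: some chain of `R`-steps leads from `a` to `b` without repetitions and
visits exactly the elements of `T`. Both color-shifting arguments recolor along such chains. -/
inductive SimpleChain {α : Type*} (R : α → α → Prop) (a : α) : Set α → α → Prop
  | single : SimpleChain R a {a} a
  | snoc {T : Set α} {b c : α} : SimpleChain R a T b → R b c → c ∉ T →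
      SimpleChain R a (insert c T) c

variable {α : Type*} {R : α → α → Prop} {a b c : α} {T : Set α}

namespace SimpleChain

theorem start_mem (h : SimpleChain R a T b) : a ∈ T := by
  induction h with
  | single => rfl
  | snoc _ _ _ ih => exact Set.mem_insert_of_mem _ ih

theorem end_mem (h : SimpleChain R a T b) : b ∈ T := by
  cases h with
  | single => rfl
  | snoc => exact Set.mem_insert _ _

theorem exists_prefix (h : SimpleChain R a T b) (hc : c ∈ T) : ∃ T', SimpleChain R a T' c := by
  induction h with
  | single => obtain rfl : c = a := hc; exact ⟨_, single⟩
  | snoc h hr hd ih =>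
    rcases hc with rfl | hc
    · exact ⟨_, snoc h hr hd⟩
    · exact ih hc

theorem of_reflTransGen (h : ReflTransGen R a b) : ∃ T, SimpleChain R a T b := by
  induction h with
  | refl => exact ⟨_, single⟩
  | @tail b c _ hr ih =>
    obtain ⟨T, hT⟩ := ih
    by_cases hc : c ∈ T
    · exact hT.exists_prefix hc
    · exact ⟨_, snoc hT hr hc⟩

theorem reflTransGen (h : SimpleChain R a T b) : ReflTransGen R a b := by
  induction h with
  | single => exact .refl
  | snoc _ hr _ ih => exact ih.tail hr

end SimpleChain

end SimpleChain

section EquitableColoring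

variable {V κ : Type*} {G : SimpleGraph V} {S P Q : Finset V} {A B C : Finset κ} {f h : V → κ}
  {a b c d : κ} {s : ℕ} {u v w y z : V}

/-- The vertices of `S` that `f` colors with `c`. -/
noncomputable def colorClass (S : Finset V) (f : V → κ) (c : κ) : Finset V := {v ∈ S | f v = c}

/-- The neighbors of `v` in the finite set `P`. -/
noncomputable def nbrs (G : SimpleGraph V) (P : Finset V) (v : V) : Finset V := {w ∈ P | G.Adj v w}

@[simp]
theorem mem_colorClass : v ∈ colorClass S f c ↔ v ∈ S ∧ f v = c := by simp [colorClass]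

@[simp]
theorem mem_nbrs : w ∈ nbrs G P v ↔ w ∈ P ∧ G.Adj v w := by simp [nbrs]

theorem nbrs_mono (hPQ : P ⊆ Q) (v : V) : nbrs G P v ⊆ nbrs G Q v := filter_subset_filter _ hPQ

theorem colorClass_erase (S : Finset V) (f : V → κ) (v : V) (c : κ) :
    colorClass (S.erase v) f c = (colorClass S f c).erase v := by
  ext; simp [and_assoc]

theorem colorClass_erase_of_ne (hc : f v ≠ c) :
    colorClass (S.erase v) f c = colorClass S f c := by
  rw [colorClass_erase, erase_eq_of_notMem (by simp [hc])]

theorem colorClass_insert_update_self (S : Finset V) (f : V → κ) (v : V) (c : κ) :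
    colorClass (insert v S) (Function.update f v c) c = insert v (colorClass S f c) := by
  ext w
  by_cases h : w = v
  · simp [h]
  · simp [h]

theorem colorClass_insert_update_of_ne (hv : v ∉ S) (hc : c ≠ d) :
    colorClass (insert v S) (Function.update f v d) c = colorClass S f c := by
  ext w
  by_cases h : w = v
  · simp [h, hv, hc.symm]
  · simp [h]

theorem colorClass_piecewise_left (hh : ∀ v ∈ Q, h v ∈ B) (hc : c ∉ B) :
    colorClass (P ∪ Q) (P.piecewise f h) c = colorClass P f c := by
  ext v
  by_cases hv : v ∈ P
  · simp [hv]
  · simpa [hv] using fun hvQ (hvc : h v = c) => hc (hvc ▸ hh v hvQ)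

theorem colorClass_piecewise_right (hPQ : Disjoint P Q) (hf : ∀ v ∈ P, f v ∈ A) (hc : c ∉ A) :
    colorClass (P ∪ Q) (P.piecewise f h) c = colorClass Q h c := by
  ext v
  by_cases hv : v ∈ P
  · simpa [hv, disjoint_left.1 hPQ hv] using fun hvc : f v = c => hc (hvc ▸ hf v hv)
  · simp [hv]

/-- `f` properly colors the subgraph induced by `S` with colors from `C`; its values off `S` are
irrelevant. -/
structure IsProperOn (G : SimpleGraph V) (S : Finset V) (C : Finset κ) (f : V → κ) : Prop where
  mem : ∀ v ∈ S, f v ∈ C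
  ne : ∀ u ∈ S, ∀ v ∈ S, G.Adj u v → f u ≠ f v

namespace IsProperOn

theorem subset (hf : IsProperOn G S C f) (hPS : P ⊆ S) : IsProperOn G P C f :=
  ⟨fun v hv => hf.mem v (hPS hv), fun u hu v hv => hf.ne u (hPS hu) v (hPS hv)⟩

theorem insert_update (hf : IsProperOn G S C f) (hd : d ∈ C) (hv : v ∉ S)
    (hvd : ∀ w ∈ colorClass S f d, ¬ G.Adj v w) :
    IsProperOn G (insert v S) C (Function.update f v d) := by
  have hne : ∀ {w}, w ∈ S → w ≠ v := fun hw => ne_of_mem_of_not_mem hw hv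
  have hvd' : ∀ w ∈ S, G.Adj v w → f w ≠ d := fun w hw hadj hwd => hvd w (by simp [hw, hwd]) hadj
  simp only [mem_colorClass] at hvd
  refine ⟨fun w hw => ?_, fun u hu w hw huw => ?_⟩
  · rcases mem_insert.1 hw with rfl | hw
    · simpa using hd
    · simpa [hne hw] using hf.mem w hw
  · rcases mem_insert.1 hu with rfl | huS <;> rcases mem_insert.1 hw with rfl | hwS
    · exact absurd huw G.irrefl
    · simpa [hne hwS] using (hvd' w hwS huw).symm
    · simpa [hne huS] using hvd' u huS huw.symm
    · simpa [hne huS, hne hwS] using hf.ne u huS w hwS huw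

theorem piecewise (hf : IsProperOn G P A f) (hh : IsProperOn G Q B h) (hAB : Disjoint A B) :
    IsProperOn G (P ∪ Q) (A ∪ B) (P.piecewise f h) := by
  have hmem : ∀ v ∈ P ∪ Q, v ∉ P → v ∈ Q := fun v hv hvP => (mem_union.1 hv).resolve_left hvP
  refine ⟨fun v hv => ?_, fun u hu v hv huv => ?_⟩
  · by_cases hvP : v ∈ P
    · simp [hvP, hf.mem v hvP]
    · simp [hvP, hh.mem v (hmem v hv hvP)]
  · by_cases huP : u ∈ P <;> by_cases hvP : v ∈ P <;> simp only [huP, hvP, not_false_eq_true,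
      piecewise_eq_of_mem, piecewise_eq_of_notMem]
    · exact hf.ne u huP v hvP huv
    · exact disjoint_iff_ne.1 hAB _ (hf.mem u huP) _ (hh.mem v (hmem v hv hvP))
    · exact (disjoint_iff_ne.1 hAB _ (hf.mem v hvP) _ (hh.mem u (hmem u hu huP))).symm
    · exact hh.ne u (hmem u hu huP) v (hmem v hv hvP) huv

end IsProperOn

/-- A proper coloring of `S` all of whose color classes have the same size `s`. -/
structure IsEquitableOn (G : SimpleGraph V) (S : Finset V) (C : Finset κ) (s : ℕ) (f : V → κ) :
    Prop where
  proper : IsProperOn G S C f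
  card_eq : ∀ c ∈ C, #(colorClass S f c) = s

/-- A proper coloring of `S` that lacks one vertex to be equitable: the class of `a` has `s - 1`
vertices and all others have `s`. -/
structure IsDeficientOn (G : SimpleGraph V) (S : Finset V) (C : Finset κ) (s : ℕ) (f : V → κ)
    (a : κ) : Prop where
  proper : IsProperOn G S C f
  mem : a ∈ C
  card_add_one : #(colorClass S f a) + 1 = s
  card_eq : ∀ c ∈ C, c ≠ a → #(colorClass S f c) = s

/-- Some vertex of `P` can be added to the independent set `Q`. -/
def Movable (G : SimpleGraph V) (P Q : Finset V) : Prop := ∃ v ∈ P, ∀ w ∈ Q, ¬ G.Adj v w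

/-- The auxiliary digraph on the colors, with its arcs reversed so that chains start at the
deficient class: some vertex of color `d` can be recolored with `c`. -/
def MoveRel (G : SimpleGraph V) (S : Finset V) (f : V → κ) (c d : κ) : Prop :=
  Movable G (colorClass S f d) (colorClass S f c)

theorem IsProperOn.mem_of_reflTransGen (hf : IsProperOn G S C f) (ha : a ∈ C)
    (hd : ReflTransGen (MoveRel G S f) a d) : d ∈ C := by
  rcases hd.cases_tail with rfl | ⟨_, -, v, hv, -⟩
  · exact ha
  · exact (mem_colorClass.1 hv).2 ▸ hf.mem v (mem_colorClass.1 hv).1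

/-- Moving one vertex along each step of the chain makes room for `v`. The relation is kept
abstract because the movable vertices are taken out of `S` as the induction goes backwards along
the chain. -/
theorem SimpleChain.exists_shift {R : κ → κ → Prop} {T : Set κ} (hT : SimpleChain R a T d)
    (ha : a ∈ C) (hf : IsProperOn G S C f)
    (hR : ∀ c ∈ T, ∀ e ∈ T, R c e → MoveRel G S f c e) (hv : v ∉ S)
    (hvd : ∀ w ∈ colorClass S f d, ¬ G.Adj v w) :
    ∃ g, IsProperOn G (insert v S) C g ∧
      (∀ c ∉ T, colorClass (insert v S) g c = colorClass S f c) ∧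
      ∀ c ∈ T, #(colorClass (insert v S) g c) =
        #(colorClass S f c) + if c = a then 1 else 0 := by
  induction hT generalizing S v with
  | single =>
    refine ⟨_, hf.insert_update ha hv hvd, fun c hc => colorClass_insert_update_of_ne hv hc, ?_⟩
    rintro c rfl
    rw [colorClass_insert_update_self, card_insert_of_notMem (by simp [hv]), if_pos rfl]
  | @snoc T e d hT hr hdT ih =>
    obtain ⟨u, hu, hue⟩ := hR e (.inr hT.end_mem) d (.inl rfl) hr
    obtain ⟨huS, hud⟩ := mem_colorClass.1 hu
    have hclass : ∀ c ∈ T, colorClass (S.erase u) f c = colorClass S f c := fun c hc =>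
      colorClass_erase_of_ne (by rintro rfl; exact hdT (hud ▸ hc))
    obtain ⟨g, hg, hgT, hgT'⟩ := ih (hf.subset (erase_subset u S))
      (fun c hc e he hce => by
        simpa only [MoveRel, hclass c hc, hclass e he] using hR c (.inr hc) e (.inr he) hce)
      (notMem_erase u S) (by rwa [hclass e hT.end_mem])
    rw [insert_erase huS] at hg hgT hgT'
    have hgd : colorClass S g d = (colorClass S f d).erase u := by
      rw [hgT d hdT, colorClass_erase]
    refine ⟨_, hg.insert_update (hud ▸ hf.mem u huS) hv
      (by rw [hgd]; exact fun w hw => hvd w (mem_of_mem_erase hw)), fun c hc => ?_, ?_⟩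
    · obtain ⟨hcd, hcT⟩ := not_or.1 hc
      rw [colorClass_insert_update_of_ne hv hcd, hgT c hcT,
        colorClass_erase_of_ne (hud ▸ Ne.symm hcd)]
    · rintro c (rfl | hc)
      · have hca : c ≠ a := fun h => hdT (h ▸ hT.start_mem)
        rw [colorClass_insert_update_self, card_insert_of_notMem (by simp [hv]), hgd,
          card_erase_add_one hu, if_neg hca, add_zero]
      · rw [colorClass_insert_update_of_ne hv (ne_of_mem_of_not_mem hc hdT), hgT' c hc, hclass c hc]

theorem IsDeficientOn.exists_isEquitableOn_insert (hf : IsDeficientOn G S C s f a)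
    (hd : ReflTransGen (MoveRel G S f) a d) (hv : v ∉ S)
    (hvd : ∀ w ∈ colorClass S f d, ¬ G.Adj v w) :
    ∃ g, IsEquitableOn G (insert v S) C s g := by
  obtain ⟨T, hT⟩ := SimpleChain.of_reflTransGen hd
  obtain ⟨g, hg, hgT, hgT'⟩ :=
    hT.exists_shift hf.mem hf.proper (fun _ _ _ _ => id) hv hvd
  refine ⟨g, hg, fun c hc => ?_⟩
  by_cases hcT : c ∈ T
  · rw [hgT' c hcT]
    split_ifs with hca
    · rw [hca, hf.card_add_one]
    · exact hf.card_eq c hc hca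
  · rw [hgT c hcT, hf.card_eq c hc (ne_of_mem_of_not_mem hT.start_mem hcT).symm]

theorem IsEquitableOn.piecewise (hf : IsEquitableOn G P A s f) (hh : IsEquitableOn G Q B s h)
    (hAB : Disjoint A B) (hPQ : Disjoint P Q) :
    IsEquitableOn G (P ∪ Q) (A ∪ B) s (P.piecewise f h) := by
  refine ⟨hf.proper.piecewise hh.proper hAB, fun c hc => ?_⟩
  rcases mem_union.1 hc with hc | hc
  · rw [colorClass_piecewise_left hh.proper.mem (disjoint_left.1 hAB hc), hf.card_eq c hc]
  · rw [colorClass_piecewise_right hPQ hf.proper.mem (disjoint_right.1 hAB hc), hh.card_eq c hc]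

theorem IsDeficientOn.piecewise (hf : IsDeficientOn G P A s f a) (hh : IsEquitableOn G Q B s h)
    (hAB : Disjoint A B) (hPQ : Disjoint P Q) :
    IsDeficientOn G (P ∪ Q) (A ∪ B) s (P.piecewise f h) a := by
  refine ⟨hf.proper.piecewise hh.proper hAB, mem_union_left _ hf.mem, ?_, fun c hc hca => ?_⟩
  · rw [colorClass_piecewise_left hh.proper.mem (disjoint_left.1 hAB hf.mem), hf.card_add_one]
  rcases mem_union.1 hc with hc | hc
  · rw [colorClass_piecewise_left hh.proper.mem (disjoint_left.1 hAB hc), hf.card_eq c hc hca]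
  · rw [colorClass_piecewise_right hPQ hf.proper.mem (disjoint_right.1 hAB hc), hh.card_eq c hc]

end EquitableColoring

section TerminalSet

variable {α : Type*} {R : α → α → Prop} {A T : Finset α} {a c U W X : α}

/-- The steps of `R` that avoid the element `X`. -/
def Avoiding (R : α → α → Prop) (X b c : α) : Prop := R b c ∧ b ≠ X ∧ c ≠ X

/-- The elements of `A` other than `X` that become unreachable from `a` when `X` is deleted. -/
noncomputable def cutOff (R : α → α → Prop) (a : α) (A : Finset α) (X : α) : Finset α :=
  {c ∈ A | c ≠ X ∧ ¬ ReflTransGen (Avoiding R X) a c}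

theorem mem_cutOff :
    c ∈ cutOff R a A X ↔ c ∈ A ∧ c ≠ X ∧ ¬ ReflTransGen (Avoiding R X) a c := by
  simp [cutOff]

theorem ne_of_reflTransGen_avoiding (haX : a ≠ X) (hc : ReflTransGen (Avoiding R X) a c) :
    c ≠ X := by
  rcases hc.cases_tail with rfl | ⟨_, -, h⟩
  · exact haX
  · exact h.2.2

theorem reflTransGen_avoiding_of_mem_cutOff (hW : W ∈ cutOff R a A U)
    (hc : ReflTransGen (Avoiding R U) a c) : ReflTransGen (Avoiding R W) a c := by
  have hWU := (mem_cutOff.1 hW).2.2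
  induction hc with
  | refl => exact .refl
  | tail hb hr ih =>
    exact ih.tail ⟨hr.1, fun h => hWU (h ▸ hb), fun h => hWU (h ▸ hb.tail hr)⟩

theorem reflTransGen_avoiding_cut (hU : ReflTransGen R a U) (hW : W ∈ cutOff R a A U) :
    ReflTransGen (Avoiding R W) a U := by
  obtain ⟨-, hWU, hWav⟩ := mem_cutOff.1 hW
  have havoid : ∀ c, ReflTransGen R a c →
      ReflTransGen (Avoiding R U) a c ∨ ReflTransGen (Avoiding R W) a U := by
    intro c hc
    induction hc with
    | refl => exact .inl .refl
    | @tail b c _ hr ih =>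
      refine ih.elim (fun hb => ?_) .inr
      by_cases hcU : c = U
      · subst hcU
        exact .inr ((reflTransGen_avoiding_of_mem_cutOff hW hb).tail
          ⟨hr, fun h => hWav (h ▸ hb), hWU.symm⟩)
      by_cases hbU : b = U
      · subst hbU
        exact .inr (reflTransGen_avoiding_of_mem_cutOff hW hb)
      · exact .inl (hb.tail ⟨hr, hbU, hcU⟩)
  exact (havoid U hU).elim (reflTransGen_avoiding_of_mem_cutOff hW) id

theorem cutOff_ssubset (hU : ReflTransGen R a U) (hW : W ∈ cutOff R a A U) :
    cutOff R a A W ⊂ cutOff R a A U := by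
  refine (ssubset_iff_of_subset fun c hc => ?_).2 ⟨W, hW, fun h => (mem_cutOff.1 h).2.1 rfl⟩
  obtain ⟨hcA, -, hcav⟩ := mem_cutOff.1 hc
  refine mem_cutOff.2 ⟨hcA, ?_, fun h => hcav (reflTransGen_avoiding_of_mem_cutOff hW h)⟩
  rintro rfl
  exact hcav (reflTransGen_avoiding_cut hU hW)

/-- `T` is a set of elements of `A` each of which can be deleted without making any other element
unreachable from `a`, and which is entered from the rest of `A` only through `U`. For `MoveRel`,
these are the terminal color classes of Kierstead and Kostochka. -/
structure IsTerminalSet (R : α → α → Prop) (a : α) (A T : Finset α) (U : α) : Prop where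
  subset : T ⊆ A
  nonempty : T.Nonempty
  cut_mem : U ∈ A
  cut_notMem : U ∉ T
  start_notMem : a ∉ T
  reach : ∀ W ∈ T, ∀ c ∈ A, c ≠ W → ReflTransGen (Avoiding R W) a c
  not_rel : ∀ W ∈ T, ∀ c ∈ A, c ∉ T → c ≠ U → ¬ R c W

/-- Deleting `U` may cut something off, e.g. for `U = a`; a minimal nonempty set cut off in this
way is terminal. -/
theorem exists_isTerminalSet (ha : a ∈ A) (hA : 1 < #A) (hreach : ∀ c ∈ A, ReflTransGen R a c) :
    ∃ T U, IsTerminalSet R a A T U := by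
  have hne : (A.filter fun X => (cutOff R a A X).Nonempty).Nonempty := by
    obtain ⟨c, hc, hca⟩ := exists_mem_ne hA a
    refine ⟨a, mem_filter.2 ⟨ha, c, mem_cutOff.2 ⟨hc, hca, fun h => ?_⟩⟩⟩
    rcases h.cases_head with h | ⟨_, h, -⟩
    · exact hca h.symm
    · exact h.2.1 rfl
  obtain ⟨U, hU, hmin⟩ := exists_min_image _ (fun X => #(cutOff R a A X)) hne
  obtain ⟨hUA, hUT⟩ := mem_filter.1 hU
  refine ⟨cutOff R a A U, U, filter_subset _ _, hUT, hUA, fun h => (mem_cutOff.1 h).2.1 rfl,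
    fun h => (mem_cutOff.1 h).2.2 .refl, fun W hW c hc hcW => ?_, fun W hW c hc hcT hcU hr => ?_⟩
  · by_contra hcav
    exact (card_lt_card (cutOff_ssubset (hreach U hUA) hW)).not_ge
      (hmin W (mem_filter.2 ⟨(mem_cutOff.1 hW).1, c, mem_cutOff.2 ⟨hc, hcW, hcav⟩⟩))
  · obtain ⟨-, hWU, hWav⟩ := mem_cutOff.1 hW
    have hcav : ReflTransGen (Avoiding R U) a c := by
      by_contra h
      exact hcT (mem_cutOff.2 ⟨hc, hcU, h⟩)
    exact hWav (hcav.tail ⟨hr, hcU, hWU⟩)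

end TerminalSet

section Counting

variable {V κ : Type*} {G : SimpleGraph V} {P Q Z : Finset V} {A T : Finset κ} {f : V → κ}
  {q s t : ℕ} {v y : V}

/-- `z` is a solo neighbor of `y`, in the terminology of Kierstead and Kostochka: the only neighbor
of `y` in the color class of `z`. -/
def IsSolo (G : SimpleGraph V) (P : Finset V) (f : V → κ) (y z : V) : Prop :=
  nbrs G (colorClass P f (f z)) y = {z}

theorem sum_card_nbrs_comm (G : SimpleGraph V) (P Q : Finset V) :
    ∑ z ∈ P, #(nbrs G Q z) = ∑ y ∈ Q, #(nbrs G P y) := by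
  have := sum_card_bipartiteAbove_eq_sum_card_bipartiteBelow (s := P) (t := Q) G.Adj
  simpa only [bipartiteAbove, bipartiteBelow, nbrs, G.adj_comm] using this

theorem card_nbrs_union (hPQ : Disjoint P Q) (v : V) :
    #(nbrs G (P ∪ Q) v) = #(nbrs G P v) + #(nbrs G Q v) := by
  rw [nbrs, filter_union, card_union_of_disjoint (disjoint_filter_filter hPQ)]
  rfl

theorem card_nbrs_eq_sum_colorClass (hf : ∀ w ∈ P, f w ∈ A) (v : V) :
    #(nbrs G P v) = ∑ c ∈ A, #(nbrs G (colorClass P f c) v) := by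
  rw [card_eq_sum_card_fiberwise (s := nbrs G P v) (t := A) fun w hw => hf w (mem_nbrs.1 hw).1]
  exact sum_congr rfl fun c _ => congrArg card (filter_comm _ _ _)

theorem card_filter_mem_eq_sum_colorClass (P : Finset V) (f : V → κ) (T : Finset κ) :
    #{w ∈ P | f w ∈ T} = ∑ c ∈ T, #(colorClass P f c) := by
  rw [card_eq_sum_card_fiberwise (s := {w ∈ P | f w ∈ T}) fun w hw =>
    (mem_filter.1 (mem_coe.1 hw)).2]
  refine sum_congr rfl fun c hc => ?_
  rw [colorClass, filter_filter]
  exact congrArg card (filter_congr fun w _ => and_iff_right_of_imp (· ▸ hc))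

theorem card_le_card_nbrs_of_adj (h : ∀ c ∈ A, ∃ w ∈ colorClass P f c, G.Adj v w) :
    #A ≤ #(nbrs G P v) := by
  refine (card_le_card fun c hc => ?_).trans (card_image_le (f := f))
  obtain ⟨w, hw, hvw⟩ := h c hc
  obtain ⟨hwP, hwc⟩ := mem_colorClass.1 hw
  exact mem_image.2 ⟨w, mem_nbrs.2 ⟨hwP, hvw⟩, hwc⟩

theorem card_add_card_le_sum_add_card_filter_eq_one {n : κ → ℕ} (hTA : T ⊆ A)
    (hn : ∀ c ∈ A, 1 ≤ n c) : #A + #T ≤ ∑ c ∈ A, n c + #{c ∈ T | n c = 1} := by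
  have hsum : ∑ c ∈ A, (1 + if c ∈ T ∧ n c ≠ 1 then 1 else 0) ≤ ∑ c ∈ A, n c := by
    refine sum_le_sum fun c hc => ?_
    have := hn c hc
    split_ifs with h <;> omega
  rw [sum_add_distrib, ← card_filter, ← filter_filter, filter_mem_eq_inter,
    inter_eq_right.2 hTA, ← card_eq_sum_ones] at hsum
  simp only [ne_eq] at hsum
  have := card_filter_add_card_filter_not (s := T) (fun c => n c = 1)
  omega

theorem card_filter_card_nbrs_eq_one_le (T : Finset κ) (f : V → κ) (y : V) :
    #{c ∈ T | #(nbrs G (colorClass P f c) y) = 1} ≤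
      #{z ∈ {z ∈ P | f z ∈ T} | IsSolo G P f y z} := by
  refine (card_le_card fun c hc => ?_).trans (card_image_le (f := f))
  obtain ⟨hcT, hc1⟩ := mem_filter.1 hc
  obtain ⟨z, hz⟩ := card_eq_one.1 hc1
  have hzmem : z ∈ nbrs G (colorClass P f c) y := hz ▸ mem_singleton_self z
  obtain ⟨hzP, rfl⟩ := mem_colorClass.1 (mem_nbrs.1 hzmem).1
  exact mem_image_of_mem f (mem_filter.2 ⟨mem_filter.2 ⟨hzP, hcT⟩, hz⟩)

theorem exists_independent_card_le_sum (G : SimpleGraph V) (Q : Finset V) :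
    ∃ I ⊆ Q, (∀ u ∈ I, ∀ v ∈ I, ¬ G.Adj u v) ∧ #Q ≤ ∑ y ∈ I, (#(nbrs G Q y) + 1) := by
  obtain ⟨I, hI, hmax⟩ := exists_max_image
    (Q.powerset.filter fun I => ∀ u ∈ I, ∀ v ∈ I, ¬ G.Adj u v) card ⟨∅, by simp⟩
  simp only [mem_filter, mem_powerset] at hI hmax
  refine ⟨I, hI.1, hI.2, ?_⟩
  have hdom : Q ⊆ I.biUnion fun y => insert y (nbrs G Q y) := by
    intro w hw
    simp only [mem_biUnion, mem_insert, mem_nbrs]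
    by_contra! hcon
    have hwI : w ∉ I := fun h => (hcon w h).1 rfl
    have hna : ∀ y ∈ I, ¬ G.Adj y w := fun y hy => (hcon y hy).2 hw
    have hins : ∀ u ∈ insert w I, ∀ v ∈ insert w I, ¬ G.Adj u v := by
      simpa [forall_and, G.adj_comm w] using ⟨hna, hI.2⟩
    have := hmax (insert w I) ⟨insert_subset hw hI.1, hins⟩
    rw [card_insert_of_notMem hwI] at this
    omega
  calc #Q ≤ _ := card_le_card hdom
    _ ≤ _ := card_biUnion_le
    _ ≤ _ := sum_le_sum fun y _ => card_insert_le _ _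

/-- Count the edges between `P` and `Q`, those at the vertices `z` of the third hypothesis twice:
each vertex of `Q` contributes at least `2`, while for `t ≤ q` each vertex of `P` would contribute
at most `2 * q`. -/
theorem lt_of_solo_degree_le (hP : #P = s) (hQ : #Q = q * s + 1)
    (hadj : ∀ y ∈ Q, ∃ z ∈ P, G.Adj y z)
    (hsolo : ∀ z ∈ P, ∀ y ∈ Q, nbrs G P y = {z} → #(nbrs G Q z) ≤ q)
    (hdeg : ∀ z ∈ P, #(nbrs G Q z) ≤ q + t) : q < t := by
  set solo : V → Prop := fun z => ∃ y ∈ Q, nbrs G P y = {z}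
  have hcount : ∀ y ∈ Q, 2 ≤ #(nbrs G P y) + #(nbrs G {z ∈ P | solo z} y) := by
    intro y hy
    obtain ⟨z, hz, hyz⟩ := hadj y hy
    have hpos : 0 < #(nbrs G P y) := card_pos.2 ⟨z, mem_nbrs.2 ⟨hz, hyz⟩⟩
    by_cases hone : #(nbrs G P y) = 1
    · obtain ⟨x, hx⟩ := card_eq_one.1 hone
      obtain ⟨hxP, hyx⟩ := mem_nbrs.1 (hx ▸ mem_singleton_self x)
      have : 0 < #(nbrs G {z ∈ P | solo z} y) :=
        card_pos.2 ⟨x, mem_nbrs.2 ⟨mem_filter.2 ⟨hxP, y, hy, hx⟩, hyx⟩⟩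
      omega
    · omega
  have hsum := sum_le_sum hcount
  rw [sum_add_distrib, ← sum_card_nbrs_comm G P Q, ← sum_card_nbrs_comm G _ Q, sum_const,
    smul_eq_mul, hQ, ← sum_filter_add_sum_filter_not P solo] at hsum
  have hle_solo : ∑ z ∈ {z ∈ P | solo z}, #(nbrs G Q z) ≤ #{z ∈ P | solo z} * q := by
    refine sum_le_card_nsmul _ _ _ fun z hz => ?_
    obtain ⟨hz, y, hy, h⟩ := mem_filter.1 hz
    exact hsolo z hz y hy h
  have hle_rest : ∑ z ∈ {z ∈ P | ¬ solo z}, #(nbrs G Q z) ≤ #{z ∈ P | ¬ solo z} * (q + t) :=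
    sum_le_card_nsmul _ _ _ fun z hz => hdeg z (mem_filter.1 hz).1
  have hs := card_filter_add_card_filter_not (s := P) solo
  rw [hP] at hs
  by_contra! hcon
  rw [← hs] at hsum
  nlinarith [Nat.mul_le_mul_left (#{z ∈ P | ¬ solo z}) hcon]

/-- Pigeonhole principle: the vertices of a suitable independent subset of `Q` have more than `#Z`
relatives in `Z` altogether. -/
theorem exists_common_of_card_lt {r : V → V → Prop} (hqt : q ≤ t) (hZ : #Z = t * s)
    (hQ : #Q = q * s + 1) (hdeg : ∀ y ∈ Q, #(nbrs G Q y) + 1 ≤ q)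
    (hr : ∀ y ∈ Q, t + 1 + #(nbrs G Q y) ≤ #{z ∈ Z | r y z} + q) :
    ∃ z ∈ Z, ∃ y₁ ∈ Q, ∃ y₂ ∈ Q, y₁ ≠ y₂ ∧ ¬ G.Adj y₁ y₂ ∧ r y₁ z ∧ r y₂ z := by
  obtain ⟨I, hIQ, hI, hsum⟩ := exists_independent_card_le_sum G Q
  have hIs : s + 1 ≤ #I := by
    have hle : ∑ y ∈ I, (#(nbrs G Q y) + 1) ≤ #I * q :=
      sum_le_card_nsmul _ _ _ fun y hy => hdeg y (hIQ hy)
    by_contra! hcon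
    have : #I * q ≤ s * q := Nat.mul_le_mul_right _ (by omega)
    nlinarith
  have hlt : #Z * 1 < ∑ z ∈ Z, #{y ∈ I | r y z} := by
    have hcomm := sum_card_bipartiteAbove_eq_sum_card_bipartiteBelow (s := I) (t := Z) r
    simp only [bipartiteAbove, bipartiteBelow] at hcomm
    have hsum' := sum_le_sum fun y hy => hr y (hIQ hy)
    simp only [sum_add_distrib, sum_const, smul_eq_mul, mul_one] at hsum' hsum
    rw [← hcomm, hZ]
    obtain ⟨e, rfl⟩ := Nat.exists_eq_add_of_le hqt
    nlinarith [Nat.mul_le_mul_left e hIs]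
  obtain ⟨z, hz, hcard⟩ : ∃ z ∈ Z, 1 < #{y ∈ I | r y z} := by
    by_contra! hcon
    exact absurd (sum_le_card_nsmul _ _ _ hcon) (not_le.2 hlt)
  obtain ⟨y₁, h₁, y₂, h₂, hne⟩ := one_lt_card.1 hcard
  obtain ⟨hy₁, hr₁⟩ := mem_filter.1 h₁
  obtain ⟨hy₂, hr₂⟩ := mem_filter.1 h₂
  exact ⟨z, hz, y₁, hIQ hy₁, y₂, hIQ hy₂, hne, hI _ hy₁ _ hy₂, hr₁, hr₂⟩

end Counting

section HajnalSzemeredi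

variable {V κ : Type*} {G : SimpleGraph V} {S P Q : Finset V} {A T : Finset κ} {f : V → κ}
  {q s : ℕ} {a U : κ} {v y z : V}

/-- The situation in which a deficient coloring cannot be completed directly: `P` consists of the
color classes accessible from the class of `a`, `Q` of the `q * s + 1` remaining vertices, and
every vertex of `Q` has a neighbor in every accessible class. -/
structure IsBlocked (G : SimpleGraph V) (P Q : Finset V) (A : Finset κ) (q s : ℕ) (f : V → κ)
    (a : κ) : Prop where
  deficient : IsDeficientOn G P A s f a
  reach : ∀ c ∈ A, ReflTransGen (MoveRel G P f) a c
  disjoint : Disjoint P Q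
  adj : ∀ y ∈ Q, ∀ c ∈ A, ∃ w ∈ colorClass P f c, G.Adj y w
  card_eq : #Q = q * s + 1
  card_nbrs_lt : ∀ v ∈ P ∪ Q, #(nbrs G (P ∪ Q) v) < #A + q

namespace IsBlocked

variable (hB : IsBlocked G P Q A q s f a)

include hB

theorem card_nbrs_add_card_nbrs_lt (hv : v ∈ P ∪ Q) :
    #(nbrs G P v) + #(nbrs G Q v) < #A + q :=
  card_nbrs_union hB.disjoint v ▸ hB.card_nbrs_lt v hv

theorem card_nbrs_outer_lt (hy : y ∈ Q) : #(nbrs G Q y) < q := by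
  have := hB.card_nbrs_add_card_nbrs_lt (mem_union_right P hy)
  have := card_le_card_nbrs_of_adj (hB.adj y hy)
  omega

theorem one_lt_card : 1 < #A := by
  by_contra! hA
  have hmem := hB.deficient.mem
  have hle : ∑ z ∈ colorClass P f a, #(nbrs G Q z) ≤ #(colorClass P f a) * q := by
    refine sum_le_card_nsmul _ _ _ fun z hz => ?_
    have := hB.card_nbrs_add_card_nbrs_lt (mem_union_left Q (mem_colorClass.1 hz).1)
    omega
  have hge : #Q * 1 ≤ ∑ y ∈ Q, #(nbrs G (colorClass P f a) y) := by
    refine card_nsmul_le_sum Q _ 1 fun y hy => ?_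
    obtain ⟨w, hw, hyw⟩ := hB.adj y hy a hmem
    exact card_pos.2 ⟨w, mem_nbrs.2 ⟨hw, hyw⟩⟩
  rw [← sum_card_nbrs_comm, hB.card_eq, ← hB.deficient.card_add_one] at hge
  nlinarith

theorem card_nbrs_outer_le (hz : z ∈ P)
    (hadj : ∀ c ∈ A, c ≠ f z → ∃ w ∈ colorClass P f c, G.Adj z w) : #(nbrs G Q z) ≤ q := by
  have hle : #(A.erase (f z)) ≤ #(nbrs G P z) :=
    card_le_card_nbrs_of_adj fun c hc => hadj c (mem_of_mem_erase hc) (ne_of_mem_erase hc)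
  rw [card_erase_of_mem (hB.deficient.proper.mem z hz)] at hle
  have := hB.card_nbrs_add_card_nbrs_lt (mem_union_left Q hz)
  omega

theorem card_nbrs_outer_le_of_isTerminalSet (hT : IsTerminalSet (MoveRel G P f) a A T U)
    (hz : z ∈ P) (hzT : f z ∈ T) : #(nbrs G Q z) ≤ q + #T := by
  have hadj : ∀ c ∈ (A \ T).erase U, ∃ w ∈ colorClass P f c, G.Adj z w := by
    intro c hc
    simp only [mem_erase, mem_sdiff] at hc
    by_contra! hna
    exact hT.not_rel _ hzT c hc.2.1 hc.2.2 hc.1 ⟨z, mem_colorClass.2 ⟨hz, rfl⟩, hna⟩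
  have hle := card_le_card_nbrs_of_adj hadj
  rw [card_erase_of_mem (mem_sdiff.2 ⟨hT.cut_mem, hT.cut_notMem⟩),
    card_sdiff_of_subset hT.subset] at hle
  have := hB.card_nbrs_add_card_nbrs_lt (mem_union_left Q hz)
  omega

theorem card_colorClass_of_isTerminalSet {c : κ} (hT : IsTerminalSet (MoveRel G P f) a A T U)
    (hc : c ∈ T) : #(colorClass P f c) = s :=
  hB.deficient.card_eq c (hT.subset hc) (ne_of_mem_of_not_mem hc hT.start_notMem)

theorem exists_common_solo (hT : IsTerminalSet (MoveRel G P f) a A T U) (hq : q ≤ #T) :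
    ∃ z ∈ P, f z ∈ T ∧ ∃ y₁ ∈ Q, ∃ y₂ ∈ Q, y₁ ≠ y₂ ∧ ¬ G.Adj y₁ y₂ ∧
      IsSolo G P f y₁ z ∧ IsSolo G P f y₂ z := by
  have hcard : #{z ∈ P | f z ∈ T} = #T * s := by
    rw [card_filter_mem_eq_sum_colorClass, ← smul_eq_mul, ← sum_const]
    exact sum_congr rfl fun c hc => hB.card_colorClass_of_isTerminalSet hT hc
  have hsolo : ∀ y ∈ Q, #T + 1 + #(nbrs G Q y) ≤
      #{z ∈ {z ∈ P | f z ∈ T} | IsSolo G P f y z} + q := by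
    intro y hy
    have hle := card_add_card_le_sum_add_card_filter_eq_one hT.subset
      (n := fun c => #(nbrs G (colorClass P f c) y)) fun c hc =>
        have ⟨w, hw, hyw⟩ := hB.adj y hy c hc
        card_pos.2 ⟨w, mem_nbrs.2 ⟨hw, hyw⟩⟩
    rw [← card_nbrs_eq_sum_colorClass hB.deficient.proper.mem] at hle
    have := card_filter_card_nbrs_eq_one_le (G := G) (P := P) T f y
    have := hB.card_nbrs_add_card_nbrs_lt (mem_union_right P hy)
    omega
  obtain ⟨z, hz, hy⟩ := exists_common_of_card_lt
    (r := IsSolo G P f) hq hcard hB.card_eq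
    (fun y hy => hB.card_nbrs_outer_lt hy) hsolo
  exact ⟨z, (mem_filter.1 hz).1, (mem_filter.1 hz).2, hy⟩

/-- In a terminal class, either some solo vertex `z` of some `y ∈ Q` can move to another class, or
counting produces a solo vertex shared by two nonadjacent vertices of `Q`. -/
theorem exists_movable_or_common_solo :
    ∃ z ∈ P, a ≠ f z ∧ (∀ c ∈ A, c ≠ f z → ReflTransGen (Avoiding (MoveRel G P f) (f z)) a c) ∧
      ∃ y ∈ Q, IsSolo G P f y z ∧
        ((∃ c ∈ A, c ≠ f z ∧ ∀ w ∈ colorClass P f c, ¬ G.Adj z w) ∨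
          (∀ c ∈ A, c ≠ f z → ∃ w ∈ colorClass P f c, G.Adj z w) ∧
            ∃ y₂ ∈ Q, y ≠ y₂ ∧ ¬ G.Adj y y₂ ∧ IsSolo G P f y₂ z) := by
  obtain ⟨T, U, hT⟩ := exists_isTerminalSet hB.deficient.mem hB.one_lt_card hB.reach
  have hstart : ∀ z, f z ∈ T → a ≠ f z := fun z hzT =>
    (ne_of_mem_of_not_mem hzT hT.start_notMem).symm
  by_cases hmov : ∃ z ∈ P, f z ∈ T ∧ ∃ y ∈ Q, IsSolo G P f y z ∧
      ∃ c ∈ A, c ≠ f z ∧ ∀ w ∈ colorClass P f c, ¬ G.Adj z w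
  · obtain ⟨z, hz, hzT, y, hy, hsolo, hc⟩ := hmov
    exact ⟨z, hz, hstart z hzT, hT.reach _ hzT, y, hy, hsolo, .inl hc⟩
  push Not at hmov
  obtain ⟨W, hW⟩ := hT.nonempty
  have hqT : q < #T := by
    refine lt_of_solo_degree_le (hB.card_colorClass_of_isTerminalSet hT hW) hB.card_eq
      (fun y hy => hB.adj y hy W (hT.subset hW)) (fun z hz y hy hsolo => ?_) fun z hz => ?_
    all_goals obtain ⟨hzP, rfl⟩ := mem_colorClass.1 hz
    · exact hB.card_nbrs_outer_le hzP (hmov z hzP hW y hy hsolo)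
    · exact hB.card_nbrs_outer_le_of_isTerminalSet hT hzP hW
  obtain ⟨z, hz, hzT, y₁, hy₁, y₂, hy₂, hne, hna, hs₁, hs₂⟩ := hB.exists_common_solo hT hqT.le
  exact ⟨z, hz, hstart z hzT, hT.reach _ hzT, y₁, hy₁, hs₁,
    .inr ⟨hmov z hz hzT y₁ hy₁ hs₁, y₂, hy₂, hne, hna, hs₂⟩⟩

end IsBlocked

theorem colorClass_swap_of_ne {c : κ} (hy : y ∉ P) (hc : c ≠ f z) :
    colorClass (insert y (P.erase z)) (Function.update f y (f z)) c = colorClass P f c := by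
  rw [colorClass_insert_update_of_ne (fun h => hy (mem_of_mem_erase h)) hc,
    colorClass_erase_of_ne hc.symm]

theorem colorClass_swap_self (P : Finset V) (f : V → κ) (y z : V) :
    colorClass (insert y (P.erase z)) (Function.update f y (f z)) (f z) =
      insert y ((colorClass P f (f z)).erase z) := by
  rw [colorClass_insert_update_self, colorClass_erase]

theorem IsSolo.not_adj {w : V} (h : IsSolo G P f y z) (hw : w ∈ (colorClass P f (f z)).erase z) :
    ¬ G.Adj y w := fun hyw =>
  ne_of_mem_erase hw (mem_singleton.1 (h ▸ mem_nbrs.2 ⟨mem_of_mem_erase hw, hyw⟩))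

theorem IsDeficientOn.swap (hf : IsDeficientOn G P A s f a) (hz : z ∈ P) (hy : y ∉ P)
    (haz : a ≠ f z) (hsolo : IsSolo G P f y z) :
    IsDeficientOn G (insert y (P.erase z)) A s (Function.update f y (f z)) a := by
  have hyP : y ∉ P.erase z := fun h => hy (mem_of_mem_erase h)
  refine ⟨(hf.proper.subset (erase_subset z P)).insert_update (hf.proper.mem z hz) hyP ?_, hf.mem,
    ?_, fun c hc hca => ?_⟩
  · rw [colorClass_erase]
    exact fun w => hsolo.not_adj
  · rw [colorClass_swap_of_ne hy haz, hf.card_add_one]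
  · by_cases hcz : c = f z
    · subst hcz
      rw [colorClass_swap_self, card_insert_of_notMem (by simp [hy]),
        card_erase_add_one (by simp [hz]), hf.card_eq _ hc hca]
    · rw [colorClass_swap_of_ne hy hcz, hf.card_eq c hc hca]

theorem reflTransGen_moveRel_of_colorClass_eq {R : κ → κ → Prop} {g : V → κ} {c : κ}
    (hR : ∀ b c, R b c → MoveRel G P f b c)
    (hclass : ∀ b, ReflTransGen R a b → colorClass S g b = colorClass P f b)
    (hc : ReflTransGen R a c) : ReflTransGen (MoveRel G S g) a c := by
  induction hc with
  | refl => exact .refl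
  | @tail b c hb hr ih =>
    refine ih.tail ?_
    rw [MoveRel, hclass b hb, hclass c (hb.tail hr)]
    exact hR b c hr

namespace IsBlocked

variable (hB : IsBlocked G P Q A q s f a)

include hB

theorem exists_isEquitableOn_insert {c : κ} (hz : z ∈ P) (haz : a ≠ f z) (hy : y ∈ Q)
    (hsolo : IsSolo G P f y z) (hcz : c ≠ f z)
    (hc : ReflTransGen (Avoiding (MoveRel G P f) (f z)) a c)
    (hzc : ∀ w ∈ colorClass P f c, ¬ G.Adj z w) :
    ∃ g, IsEquitableOn G (insert y P) A s g := by
  have hyP : y ∉ P := disjoint_right.1 hB.disjoint hy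
  have hreach := reflTransGen_moveRel_of_colorClass_eq (fun _ _ h => h.1) (fun b hb =>
    colorClass_swap_of_ne hyP (ne_of_reflTransGen_avoiding haz hb)) hc
  have hzS : z ∉ insert y (P.erase z) := by simp [ne_of_mem_of_not_mem hz hyP]
  have := (hB.deficient.swap hz hyP haz hsolo).exists_isEquitableOn_insert hreach hzS
    (by rwa [colorClass_swap_of_ne hyP hcz])
  rwa [insert_comm, insert_erase hz] at this

theorem reach_swap (haz : a ≠ f z)
    (hreach : ∀ c ∈ A, c ≠ f z → ReflTransGen (Avoiding (MoveRel G P f) (f z)) a c)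
    (hz : z ∈ P) (hy : y ∈ Q) (hadj : ∀ c ∈ A, c ≠ f z → ∃ w ∈ colorClass P f c, G.Adj z w)
    {c : κ} (hc : c ∈ A) :
    ReflTransGen (MoveRel G (insert y (P.erase z)) (Function.update f y (f z))) a c := by
  have hyP : y ∉ P := disjoint_right.1 hB.disjoint hy
  have hne : ∀ c ∈ A, c ≠ f z →
      ReflTransGen (MoveRel G (insert y (P.erase z)) (Function.update f y (f z))) a c :=
    fun c hc hcz => reflTransGen_moveRel_of_colorClass_eq (fun _ _ h => h.1) (fun b hb =>
      colorClass_swap_of_ne hyP (ne_of_reflTransGen_avoiding haz hb)) (hreach c hc hcz)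
  by_cases hcz : c = f z
  swap
  · exact hne c hc hcz
  subst hcz
  obtain ⟨T, hT⟩ := SimpleChain.of_reflTransGen (hB.reach (f z) hc)
  generalize hW : f z = W at hT
  cases hT with
  | single => exact absurd hW.symm haz
  | @snoc T d _ hT hr hzT =>
    subst hW
    have hdA := hB.deficient.proper.mem_of_reflTransGen hB.deficient.mem hT.reflTransGen
    have hdz : d ≠ f z := ne_of_mem_of_not_mem hT.end_mem hzT
    obtain ⟨w, hw, hwd⟩ := hr
    have hwz : w ≠ z := by
      rintro rfl
      obtain ⟨u, hu, hwu⟩ := hadj d hdA hdz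
      exact hwd u hu hwu
    refine (hne d hdA hdz).tail ⟨w, ?_, by rwa [colorClass_swap_of_ne hyP hdz]⟩
    rw [colorClass_swap_self]
    exact mem_insert_of_mem (mem_erase.2 ⟨hwz, hw⟩)

/-- After exchanging the shared solo vertex `z` of `y` and `y₂` with `y`, the vertex `y₂` can be
recolored with the color of `z`, so its own color becomes accessible. -/
theorem exists_more_reachable {B : Finset κ} {h : V → κ} {y₂ : V} (hz : z ∈ P) (haz : a ≠ f z)
    (hreach : ∀ c ∈ A, c ≠ f z → ReflTransGen (Avoiding (MoveRel G P f) (f z)) a c)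
    (hadj : ∀ c ∈ A, c ≠ f z → ∃ w ∈ colorClass P f c, G.Adj z w) (hy : y ∈ Q)
    (hsolo : IsSolo G P f y z) (hy₂ : y₂ ∈ Q) (hne : y ≠ y₂) (hna : ¬ G.Adj y y₂)
    (hsolo₂ : IsSolo G P f y₂ z) (hh : IsEquitableOn G (Q.erase y) B s h) (hAB : Disjoint A B) :
    ∃ g, IsDeficientOn G ((P ∪ Q).erase z) (A ∪ B) s g a ∧
      (∀ c ∈ A, ReflTransGen (MoveRel G ((P ∪ Q).erase z) g) a c) ∧
      ∃ b ∈ B, ReflTransGen (MoveRel G ((P ∪ Q).erase z) g) a b := by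
  have hyP : y ∉ P := disjoint_right.1 hB.disjoint hy
  have hdisj : Disjoint (insert y (P.erase z)) (Q.erase y) :=
    disjoint_insert_left.2 ⟨notMem_erase y Q,
      hB.disjoint.mono (erase_subset z P) (erase_subset y Q)⟩
  have hunion : (P ∪ Q).erase z = insert y (P.erase z) ∪ Q.erase y := by
    rw [erase_union_distrib, erase_eq_of_notMem (disjoint_left.1 hB.disjoint hz), insert_union,
      ← union_insert, insert_erase hy]
  have hswap := hB.deficient.swap hz hyP haz hsolo
  have hclass : ∀ c ∈ A, colorClass (insert y (P.erase z) ∪ Q.erase y)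
      ((insert y (P.erase z)).piecewise (Function.update f y (f z)) h) c =
        colorClass (insert y (P.erase z)) (Function.update f y (f z)) c := fun c hc =>
    colorClass_piecewise_left hh.proper.mem (disjoint_left.1 hAB hc)
  rw [hunion]
  refine ⟨_, hswap.piecewise hh hAB hdisj, ?_⟩
  have hreachA := fun c hc => reflTransGen_moveRel_of_colorClass_eq (fun _ _ => id)
    (fun b hb => hclass b (hswap.proper.mem_of_reflTransGen hswap.mem hb))
    (hB.reach_swap haz hreach hz hy hadj (c := c) hc)
  have hy₂Q : y₂ ∈ Q.erase y := mem_erase.2 ⟨hne.symm, hy₂⟩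
  have hzA : f z ∈ A := hB.deficient.proper.mem z hz
  refine ⟨hreachA, h y₂, hh.proper.mem y₂ hy₂Q,
    (hreachA (f z) hzA).tail ⟨y₂, mem_colorClass.2 ⟨mem_union_right _ hy₂Q, ?_⟩, ?_⟩⟩
  · exact piecewise_eq_of_notMem _ _ _ (disjoint_right.1 hdisj hy₂Q)
  · rw [hclass _ hzA, colorClass_swap_self]
    intro w hw hadjw
    rcases mem_insert.1 hw with rfl | hw
    · exact hna hadjw.symm
    · exact hsolo₂.not_adj hw hadjw

end IsBlocked

variable {C : Finset κ}

theorem IsDeficientOn.card_add_one_eq (hf : IsDeficientOn G S C s f a) : #S + 1 = #C * s := by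
  have hrest : ∑ c ∈ C.erase a, #(colorClass S f c) = #(C.erase a) * s :=
    sum_const_nat fun c hc => hf.card_eq c (mem_of_mem_erase hc) (ne_of_mem_erase hc)
  have hS : #S = ∑ c ∈ C, #(colorClass S f c) := card_eq_sum_card_fiberwise hf.proper.mem
  rw [hS, ← add_sum_erase C _ hf.mem, hrest, add_right_comm, hf.card_add_one,
    ← card_erase_add_one hf.mem, add_mul, one_mul, add_comm]

/-- The colors that can be reached from `a` by moving vertices. -/
noncomputable def accessible (G : SimpleGraph V) (S : Finset V) (C : Finset κ) (f : V → κ)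
    (a : κ) : Finset κ := {c ∈ C | ReflTransGen (MoveRel G S f) a c}

theorem mem_accessible {c : κ} :
    c ∈ accessible G S C f a ↔ c ∈ C ∧ ReflTransGen (MoveRel G S f) a c := by
  simp [accessible]

theorem IsDeficientOn.isBlocked {X : Finset V} (hv : v ∈ X)
    (hf : IsDeficientOn G (X.erase v) C s f a)
    (hdeg : ∀ w ∈ X, #(nbrs G X w) < #C)
    (hadj : ∀ c ∈ accessible G (X.erase v) C f a, ∃ w ∈ colorClass (X.erase v) f c, G.Adj v w) :
    IsBlocked G {w ∈ X.erase v | f w ∈ accessible G (X.erase v) C f a}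
      (X \ {w ∈ X.erase v | f w ∈ accessible G (X.erase v) C f a})
      (accessible G (X.erase v) C f a) #(C \ accessible G (X.erase v) C f a) s f a := by
  set A := accessible G (X.erase v) C f a
  set P : Finset V := {w ∈ X.erase v | f w ∈ A}
  have hAC : A ⊆ C := filter_subset _ _
  have hPX : P ⊆ X := (filter_subset _ _).trans (erase_subset _ _)
  have haA : a ∈ A := mem_accessible.2 ⟨hf.mem, .refl⟩
  have hclass : ∀ c ∈ A, colorClass P f c = colorClass (X.erase v) f c := fun c hc => by
    rw [colorClass, filter_filter]
    exact filter_congr fun w _ => and_iff_right_of_imp (· ▸ hc)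
  have hdef : IsDeficientOn G P A s f a :=
    ⟨⟨fun w hw => (mem_filter.1 hw).2, (hf.proper.subset (filter_subset _ _)).ne⟩, haA,
      by rw [hclass a haA, hf.card_add_one],
      fun c hc hca => by rw [hclass c hc, hf.card_eq c (hAC hc) hca]⟩
  have hreach : ∀ b, ReflTransGen (MoveRel G (X.erase v) f) a b → b ∈ A := fun b hb =>
    mem_accessible.2 ⟨hf.proper.mem_of_reflTransGen hf.mem hb, hb⟩
  have hcard : #A + #(C \ A) = #C := by rw [add_comm, card_sdiff_add_card_eq_card hAC]
  refine ⟨hdef, fun c hc => reflTransGen_moveRel_of_colorClass_eq (fun _ _ => id)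
    (fun b hb => hclass b (hreach b hb)) (mem_accessible.1 hc).2, disjoint_sdiff,
    fun y hy c hc => ?_, ?_, by rwa [union_sdiff_of_subset hPX, hcard]⟩
  · rw [hclass c hc]
    by_cases hyv : y = v
    · exact hyv ▸ hadj c hc
    obtain ⟨hyX, hyP⟩ := mem_sdiff.1 hy
    have hyX' : y ∈ X.erase v := mem_erase.2 ⟨hyv, hyX⟩
    by_contra! hna
    exact hyP (mem_filter.2 ⟨hyX', hreach _
      ((mem_accessible.1 hc).2.tail ⟨y, mem_colorClass.2 ⟨hyX', rfl⟩, hna⟩)⟩)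
  · have hX := hf.card_add_one_eq
    rw [card_erase_add_one hv, ← hcard, add_mul, ← hdef.card_add_one_eq] at hX
    have := card_sdiff_add_card_eq_card hPX
    omega

/-- Shifting colors completes `f` unless it is blocked. In the blocked case either a solo vertex
`z` can be moved inside the accessible part, or exchanging `z` with `y` makes one more color
accessible while `z` becomes the vertex to insert. -/
theorem IsDeficientOn.exists_isEquitableOn {X : Finset V}
    (ih : ∀ (Q : Finset V) (B : Finset κ), #B < #C → #Q = #B * s →
      (∀ v ∈ Q, #(nbrs G Q v) < #B) → ∃ h, IsEquitableOn G Q B s h)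
    (hdeg : ∀ w ∈ X, #(nbrs G X w) < #C) (hv : v ∈ X) (hf : IsDeficientOn G (X.erase v) C s f a) :
    ∃ g, IsEquitableOn G X C s g := by
  induction hn : #(C \ accessible G (X.erase v) C f a) using Nat.strong_induction_on
    generalizing v f with | _ n ihn
  by_cases hadj : ∀ c ∈ accessible G (X.erase v) C f a,
      ∃ w ∈ colorClass (X.erase v) f c, G.Adj v w
  swap
  · push Not at hadj
    obtain ⟨c, hc, hvc⟩ := hadj
    simpa [insert_erase hv] using
      hf.exists_isEquitableOn_insert (mem_accessible.1 hc).2 (notMem_erase v X) hvc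
  have hB := hf.isBlocked hv hdeg hadj
  set A := accessible G (X.erase v) C f a
  set P : Finset V := {w ∈ X.erase v | f w ∈ A}
  have hPX : P ⊆ X := (filter_subset _ _).trans (erase_subset _ _)
  have hAC : A ∪ C \ A = C := union_sdiff_of_subset (filter_subset _ _)
  obtain ⟨z, hz, haz, hreach, y, hy, hsolo, hcases⟩ := hB.exists_movable_or_common_solo
  obtain ⟨h, hh⟩ : ∃ h, IsEquitableOn G ((X \ P).erase y) (C \ A) s h := by
    refine ih _ _ (card_lt_card (sdiff_ssubset (filter_subset _ _) ⟨a, hB.deficient.mem⟩)) ?_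
      fun w hw => (card_le_card (nbrs_mono (erase_subset _ _) w)).trans_lt
        (hB.card_nbrs_outer_lt (mem_of_mem_erase hw))
    rw [card_erase_of_mem hy, hB.card_eq, Nat.add_sub_cancel]
  rcases hcases with ⟨c, hc, hcz, hzc⟩ | ⟨hzadj, y₂, hy₂, hne, hna, hsolo₂⟩
  · obtain ⟨g, hg⟩ := hB.exists_isEquitableOn_insert hz haz hy hsolo hcz (hreach c hc hcz) hzc
    have hX : insert y P ∪ (X \ P).erase y = X := by
      rw [insert_union, ← union_insert, insert_erase hy, union_sdiff_of_subset hPX]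
    have hdisj : Disjoint (insert y P) ((X \ P).erase y) :=
      disjoint_insert_left.2 ⟨notMem_erase _ _, disjoint_sdiff.mono_right (erase_subset _ _)⟩
    exact ⟨_, hAC ▸ hX ▸ hg.piecewise hh disjoint_sdiff hdisj⟩
  obtain ⟨g, hg, hgA, b, hb, hgb⟩ := hB.exists_more_reachable hz haz hreach hzadj hy hsolo hy₂ hne
    hna hsolo₂ hh disjoint_sdiff
  rw [union_sdiff_of_subset hPX] at hg hgA hgb
  rw [hAC] at hg
  refine ihn _ ?_ (hPX hz) hg rfl
  rw [← hn]
  have hle : A ⊆ accessible G (X.erase z) C g a := fun c hc =>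
    mem_accessible.2 ⟨(mem_accessible.1 hc).1, hgA c hc⟩
  exact card_lt_card ((ssubset_iff_of_subset (sdiff_subset_sdiff subset_rfl hle)).2
    ⟨b, hb, fun hb' => (mem_sdiff.1 hb').2 (mem_accessible.2 ⟨(mem_sdiff.1 hb).1, hgb⟩)⟩)

theorem IsEquitableOn.isDeficientOn_erase {H : SimpleGraph V} (hf : IsEquitableOn G S C s f)
    (hv : v ∈ S) (hH : ∀ u ∈ S.erase v, ∀ w ∈ S.erase v, H.Adj u w → G.Adj u w) :
    IsDeficientOn H (S.erase v) C s f (f v) := by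
  refine ⟨⟨(hf.proper.subset (erase_subset v S)).mem, fun u hu w hw huw =>
    (hf.proper.subset (erase_subset v S)).ne u hu w hw (hH u hu w hw huw)⟩,
    hf.proper.mem v hv, ?_, fun c hc hcv => ?_⟩
  · rw [colorClass_erase, card_erase_add_one (by simp [hv]), hf.card_eq _ (hf.proper.mem v hv)]
  · rw [colorClass_erase_of_ne hcv.symm, hf.card_eq c hc]

theorem exists_isEquitableOn_bot [Nonempty κ] (hS : #S = #C * s) :
    ∃ f, IsEquitableOn (⊥ : SimpleGraph V) S C s f := by
  induction C using Finset.induction_on generalizing S with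
  | empty =>
    obtain rfl : S = ∅ := by simpa using hS
    exact ⟨fun _ => Classical.arbitrary κ, ⟨by simp, by simp⟩, by simp⟩
  | insert c C hc ih =>
    rw [card_insert_of_notMem hc, add_mul, one_mul] at hS
    obtain ⟨P, hPS, hP⟩ := exists_subset_card_eq (s := S) (n := s) (by omega)
    obtain ⟨f, hf⟩ := ih (S := S \ P) (by rw [card_sdiff_of_subset hPS]; omega)
    have hc' : IsEquitableOn (⊥ : SimpleGraph V) P {c} s fun _ => c :=
      ⟨⟨by simp, by simp⟩, by simpa [colorClass] using hP⟩
    have := hc'.piecewise hf (disjoint_singleton_left.2 hc) disjoint_sdiff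
    rw [union_sdiff_of_subset hPS] at this
    exact ⟨_, this⟩

/-- The Hajnal–Szemerédi theorem, by the argument of Kierstead and Kostochka: the edges of `G` are
added one vertex at a time. -/
theorem exists_isEquitableOn [Nonempty κ] (hS : #S = #C * s)
    (hdeg : ∀ v ∈ S, #(nbrs G S v) < #C) : ∃ f, IsEquitableOn G S C s f := by
  induction hk : #C using Nat.strong_induction_on generalizing G S C with | _ k ih
  suffices h : ∀ T ⊆ S, ∃ f, IsEquitableOn ((⊤ : G.Subgraph).induce T).spanningCoe S C s f by
    obtain ⟨f, hf⟩ := h S subset_rfl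
    exact ⟨f, ⟨hf.proper.mem, fun u hu v hv huv =>
      hf.proper.ne u hu v hv (by simpa [hu, hv] using huv)⟩, hf.card_eq⟩
  intro T hT
  induction T using Finset.induction_on with
  | empty =>
    obtain ⟨f, hf⟩ := exists_isEquitableOn_bot hS
    exact ⟨f, ⟨hf.proper.mem, by simp⟩, hf.card_eq⟩
  | insert u T _ ihT =>
    obtain ⟨huS, hTS⟩ := insert_subset_iff.1 hT
    obtain ⟨f, hf⟩ := ihT hTS
    have hle : ((⊤ : G.Subgraph).induce ↑(insert u T)).spanningCoe ≤ G := Subgraph.spanningCoe_le _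
    refine (hf.isDeficientOn_erase huS fun v hv w hw => ?_).exists_isEquitableOn
      (fun Q B hB hQ hQB => ih _ (hk ▸ hB) hQ hQB rfl) (fun v hv => ?_) huS
    · simp only [Subgraph.spanningCoe_adj, Subgraph.induce_adj, mem_coe, mem_insert,
        ne_of_mem_erase hv, ne_of_mem_erase hw, false_or]
      exact id
    · exact (card_le_card (monotone_filter_right S fun w _ h => hle h)).trans_lt (hdeg v hv)

/-- The Hajnal–Szemerédi theorem gives classes of size exactly `r` after padding `G` with isolated
vertices. -/
theorem exists_coloring_card_le [Fintype V] {k r : ℕ} (hdeg : ∀ v, #{w | G.Adj v w} < k)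
    (hcard : Fintype.card V ≤ r * k) :
    ∃ f : V → Fin k, (∀ u v, G.Adj u v → f u ≠ f v) ∧ ∀ c, #{v | f v = c} ≤ r := by
  rcases isEmpty_or_nonempty V with hV | ⟨⟨v₀⟩⟩
  · exact ⟨isEmptyElim, fun u => isEmptyElim u, fun c => by simp⟩
  have hk : Nonempty (Fin k) := ⟨⟨0, (Nat.zero_le _).trans_lt (hdeg v₀)⟩⟩
  have hW : #(univ : Finset (V ⊕ Fin (r * k - Fintype.card V))) = #(univ : Finset (Fin k)) * r := by
    simp only [card_univ, Fintype.card_sum, Fintype.card_fin, mul_comm k r]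
    omega
  have hnbrs : ∀ v ∈ (univ : Finset (V ⊕ Fin (r * k - Fintype.card V))),
      #(nbrs (G ⊕g ⊥) univ v) < #(univ : Finset (Fin k)) := by
    rintro (v | v) -
    · have : nbrs (G ⊕g ⊥) univ (.inl v) =
          ({w | G.Adj v w} : Finset V).map (.inl : V ↪ V ⊕ Fin (r * k - Fintype.card V)) := by
        ext (w | w) <;> simp
      simpa [this] using hdeg v
    · have : nbrs (G ⊕g ⊥) univ (.inr v) = ∅ := by ext (w | w) <;> simp
      simpa [this] using Fin.pos_iff_nonempty.2 hk
  obtain ⟨f, hf⟩ := exists_isEquitableOn hW hnbrs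
  refine ⟨fun v => f (.inl v), fun u v huv =>
    hf.proper.ne _ (mem_univ _) _ (mem_univ _) (by simpa using huv), fun c => ?_⟩
  exact (card_le_card_of_injOn Sum.inl (fun v hv => by simpa using hv)
    Sum.inl_injective.injOn).trans_eq (hf.card_eq c (mem_univ c))

end HajnalSzemeredi

section PathEnds

variable {V : Type*} {H : SimpleGraph V} {S Z : Finset V} {v w x : V}

theorem reachable_deleteIncidenceSet_or (h : H.Reachable v w)
    (hv : v ≠ x) : (H.deleteIncidenceSet x).Reachable v w ∨
      ∃ u, H.Adj x u ∧ (H.deleteIncidenceSet x).Reachable v u := by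
  obtain ⟨p⟩ := h
  induction p with
  | nil => exact .inl (Reachable.refl _)
  | @cons u v w huv _ ih =>
    by_cases hvx : v = x
    · exact .inr ⟨u, hvx ▸ huv.symm, Reachable.refl _⟩
    have hr : (H.deleteIncidenceSet x).Reachable u v :=
      (deleteIncidenceSet_adj.2 ⟨huv, hv, hvx⟩).reachable
    rcases ih hvx with h | ⟨z, hz, h⟩
    · exact .inl (hr.trans h)
    · exact .inr ⟨z, hz, hr.trans h⟩

/-- A connected graph on `n` vertices has at least `n - 1` edges, so its degrees add up to at least
`2 * n - 2`: at most two of them can fall short of the bound `2`. -/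
theorem not_reachable_three_ends [Fintype V] (hH : ∀ v, #{w | H.Adj v w} ≤ 2) {a b d : V}
    (hab : a ≠ b) (had : a ≠ d) (hbd : b ≠ d) (ha : #{w | H.Adj a w} ≤ 1)
    (hb : #{w | H.Adj b w} ≤ 1) (hd : #{w | H.Adj d w} ≤ 1) (hrb : H.Reachable a b) :
    ¬ H.Reachable a d := by
  intro hrd
  set C := H.connectedComponentMk a
  have hmem : ∀ v, H.Reachable a v → v ∈ C := fun v hv => ConnectedComponent.sound hv.symm
  have hedges := C.connected_toSimpleGraph.card_vert_le_card_edgeSet_add_one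
  have hsum := C.toSimpleGraph.sum_degrees_eq_twice_card_edges
  have hdeg : ∀ v : C, C.toSimpleGraph.degree v ≤ #{w | H.Adj v w} := by
    intro v
    rw [← card_neighborFinset_eq_degree]
    refine card_le_card_of_injOn (fun w => (w : V)) (fun w hw => ?_) Subtype.val_injective.injOn
    have : H.Adj v w := (mem_neighborFinset C.toSimpleGraph v w).1 (mem_coe.1 hw)
    simpa using this
  let E : Finset C := {⟨a, hmem a (Reachable.refl _)⟩, ⟨b, hmem b hrb⟩, ⟨d, hmem d hrd⟩}
  have hE3 : #E = 3 := card_eq_three.2 ⟨_, _, _, by simpa using hab, by simpa using had,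
    by simpa using hbd, rfl⟩
  have hle : ∑ v : C, C.toSimpleGraph.degree v + #E ≤ ∑ v : C, 2 := by
    rw [show #E = ∑ v : C, if v ∈ E then 1 else 0 by simp, ← sum_add_distrib]
    refine sum_le_sum fun v _ => ?_
    have hv2 := hH v
    have hle := hdeg v
    split_ifs with hv
    · have : #{w | H.Adj v w} ≤ 1 := by
        simp only [E, mem_insert, mem_singleton] at hv
        rcases hv with rfl | rfl | rfl <;> assumption
      omega
    · omega
  rw [Nat.card_eq_fintype_card, Nat.card_eq_fintype_card, ← edgeFinset_card] at hedges
  simp only [sum_const, card_univ, smul_eq_mul] at hle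
  omega

theorem card_le_card_of_reachable_ends [Fintype V] (hH : ∀ v, #{w | H.Adj v w} ≤ 2)
    (hS : ∀ v ∈ S, #{w | H.Adj v w} ≤ 1) (hZ : ∀ v ∈ Z, #{w | H.Adj v w} ≤ 1)
    (hSZ : ∀ v ∈ S, v ∈ Z → ∀ w, ¬ H.Adj v w) (hr : ∀ v ∈ S, ∃ w ∈ Z, H.Reachable v w) :
    #S ≤ #Z := by
  choose! g hg hgr using hr
  refine card_le_card_of_injOn g hg fun u hu v hv huv => ?_
  have hgv : H.Reachable v (g u) := huv ▸ hgr v hv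
  have hisolated : ∀ {a b}, a ∈ S → a ∈ Z → H.Reachable a b → a = b := by
    rintro a b haS haZ ⟨p⟩
    cases p with
    | nil => rfl
    | cons hadj _ => exact absurd hadj (hSZ a haS haZ _)
  by_contra hne
  by_cases hu' : u = g u
  · exact hne (hisolated hu (hu' ▸ hg u hu) (hu' ▸ hgv.symm))
  by_cases hv' : v = g u
  · exact hne (hisolated hv (hv' ▸ hg u hu) (hv' ▸ (hgr u hu).symm)).symm
  exact not_reachable_three_ends hH hne hu' hv' (hS u hu) (hS v hv) (hZ _ (hg u hu))
    ((hgr u hu).trans hgv.symm) (hgr u hu)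

end PathEnds

section EdgeColoring

variable {V K : Type*} {G : SimpleGraph V} {c : V → Option K} {φ ψ : Sym2 V → Option K}
  {a α β : K} {b p v x y z : V} {C T : Set V}

/-- A partial proper edge coloring of `G` in which no edge at `v` has color `c v`. Edges that are
not colored have the value `none`; likewise `c v = none` imposes no restriction at `v`. -/
structure IsPartialEdgeColoring (G : SimpleGraph V) (c : V → Option K) (φ : Sym2 V → Option K) :
    Prop where
  adj : ∀ u v a, φ s(u, v) = some a → G.Adj u v
  inj : ∀ u v w a, φ s(u, v) = some a → φ s(u, w) = some a → v = w
  avoid : ∀ u v a, φ s(u, v) = some a → c u ≠ some a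

/-- The color `a` is neither the color of `v` nor of an edge at `v`. -/
def Missing (c : V → Option K) (φ : Sym2 V → Option K) (v : V) (a : K) : Prop :=
  (∀ w, φ s(v, w) ≠ some a) ∧ c v ≠ some a

/-- The number of edges that have received a color, to be maximized. -/
noncomputable def coloredCount [Fintype V] (φ : Sym2 V → Option K) : ℕ := #{e | (φ e).isSome}

/-- `φ` has as many colored edges as possible and nevertheless leaves the edge `xy` uncolored. -/
structure IsMaxUncolored [Fintype V] (G : SimpleGraph V) (c : V → Option K)
    (φ : Sym2 V → Option K) (x y : V) : Prop where
  isPartial : IsPartialEdgeColoring G c φ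
  max : ∀ ψ, IsPartialEdgeColoring G c ψ → coloredCount ψ ≤ coloredCount φ
  adj : G.Adj x y
  uncolored : φ s(x, y) = none

/-- Exchange the colors `α` and `β` on all edges that meet `C`. -/
noncomputable def swapOn (C : Set V) (α β : K) (φ : Sym2 V → Option K) : Sym2 V → Option K :=
  fun e => if ∃ v ∈ e, v ∈ C then (φ e).map (Equiv.swap α β) else φ e

theorem swapOn_of_mem {u : V} (hu : u ∈ C) :
    swapOn C α β φ s(u, v) = some a ↔ φ s(u, v) = some (Equiv.swap α β a) := by
  rw [swapOn, if_pos ⟨u, Sym2.mem_mk_left u v, hu⟩, Option.map_eq_some_iff]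
  constructor
  · rintro ⟨b, hb, rfl⟩
    simpa using hb
  · exact fun h => ⟨_, h, Equiv.swap_apply_self _ _ _⟩

theorem swapOn_of_notMem {u : V}
    (hC : ∀ u ∈ C, ∀ v, φ s(u, v) = some α ∨ φ s(u, v) = some β → v ∈ C) (hu : u ∉ C) :
    swapOn C α β φ s(u, v) = φ s(u, v) := by
  rw [swapOn]
  split_ifs with h
  swap
  · rfl
  have hv : v ∈ C := by
    obtain ⟨w, hw, hwC⟩ := h
    rcases Sym2.mem_iff.1 hw with rfl | rfl
    exacts [absurd hwC hu, hwC]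
  have hne : ∀ a, φ s(u, v) = some a → a ≠ α ∧ a ≠ β := fun a ha => by
    rw [Sym2.eq_swap] at ha
    constructor <;> rintro rfl
    exacts [hu (hC v hv u (.inl ha)), hu (hC v hv u (.inr ha))]
  rcases ho : φ s(u, v) with _ | a
  · rfl
  · simp [Equiv.swap_apply_of_ne_of_ne (hne a ho).1 (hne a ho).2]

theorem coloredCount_swapOn [Fintype V] (C : Set V) (α β : K) (φ : Sym2 V → Option K) :
    coloredCount (swapOn C α β φ) = coloredCount φ := by
  refine congrArg card (filter_congr fun e _ => ?_)
  rw [swapOn]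
  split_ifs <;> simp

theorem missing_swapOn_of_mem (hc : c v ≠ some β) (hv : v ∈ C) (hα : Missing c φ v α) :
    Missing c (swapOn C α β φ) v β :=
  ⟨fun w hw => hα.1 w (by simpa using (swapOn_of_mem hv).1 hw), hc⟩

theorem missing_swapOn_of_notMem
    (hC : ∀ u ∈ C, ∀ v, φ s(u, v) = some α ∨ φ s(u, v) = some β → v ∈ C) (hv : v ∉ C)
    (ha : Missing c φ v a) : Missing c (swapOn C α β φ) v a :=
  ⟨fun w hw => ha.1 w (swapOn_of_notMem hC hv ▸ hw), ha.2⟩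

theorem card_le_of_forall_not_missing {N : Finset V} {U : Finset K}
    (hU : ∀ a ∈ U, ¬ Missing c φ v a) (hN : ∀ a ∈ U, ∀ w, φ s(v, w) = some a → w ∈ N) :
    #U ≤ #N + #(c v).toFinset := by
  have hsub : U ⊆ (N.biUnion fun w => (φ s(v, w)).toFinset) ∪ (c v).toFinset := by
    intro a ha
    have hmiss := hU a ha
    simp only [Missing, not_and_or, not_forall, ne_eq, not_not] at hmiss
    rcases hmiss with ⟨w, hw⟩ | hc
    · exact mem_union_left _ (mem_biUnion.2 ⟨w, hN a ha w hw, by simp [hw]⟩)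
    · exact mem_union_right _ (by simp [hc])
  have hone : ∀ w ∈ N, #(φ s(v, w)).toFinset ≤ 1 := fun w _ => by cases φ s(v, w) <;> simp
  calc
    #U ≤ #(N.biUnion fun w => (φ s(v, w)).toFinset) + #(c v).toFinset :=
      (card_le_card hsub).trans (card_union_le _ _)
    _ ≤ #N * 1 + #(c v).toFinset := Nat.add_le_add_right (card_biUnion_le_card_mul N _ 1 hone) _
    _ = #N + #(c v).toFinset := by rw [mul_one]

theorem card_univ_le_card_missing_add [Fintype K] {N : Finset V}
    (hN : ∀ w a, φ s(v, w) = some a → w ∈ N) :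
    Fintype.card K ≤ #{a | Missing c φ v a} + #N + #(c v).toFinset := by
  rw [← card_univ, ← card_filter_add_card_filter_not (s := univ) (fun a => Missing c φ v a),
    add_assoc]
  exact Nat.add_le_add_left (card_le_of_forall_not_missing (fun a ha => (mem_filter.1 ha).2)
    fun a _ w => hN w a) _

namespace IsPartialEdgeColoring

theorem update_none (h : IsPartialEdgeColoring G c φ) (e : Sym2 V) :
    IsPartialEdgeColoring G c (Function.update φ e none) := by
  have hle : ∀ {e' a}, Function.update φ e none e' = some a → φ e' = some a := by
    intro e' a
    by_cases he : e' = e <;> simp [he]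
  exact ⟨fun u v a hu => h.adj u v a (hle hu), fun u v w a hu hv => h.inj u v w a (hle hu) (hle hv),
    fun u v a hu => h.avoid u v a (hle hu)⟩

theorem update_some (h : IsPartialEdgeColoring G c φ) (hxy : G.Adj x y) (hx : Missing c φ x a)
    (hy : Missing c φ y a) : IsPartialEdgeColoring G c (Function.update φ s(x, y) (some a)) := by
  have hmiss : ∀ {u v}, s(u, v) = s(x, y) → Missing c φ u a := by
    intro u v huv
    rcases Sym2.eq_iff.1 huv with ⟨rfl, -⟩ | ⟨rfl, -⟩
    exacts [hx, hy]
  refine ⟨fun u v b hu => ?_, fun u v w b hu hw => ?_, fun u v b hu => ?_⟩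
  · by_cases huv : s(u, v) = s(x, y)
    · rwa [← mem_edgeSet, huv]
    · exact h.adj u v b (by simpa [huv] using hu)
  · by_cases huv : s(u, v) = s(x, y) <;> by_cases huw : s(u, w) = s(x, y)
    · exact Sym2.congr_right.1 (huv.trans huw.symm)
    · obtain rfl : a = b := by simpa [huv] using hu
      exact absurd (by simpa [huw] using hw) ((hmiss huv).1 w)
    · obtain rfl : a = b := by simpa [huw] using hw
      exact absurd (by simpa [huv] using hu) ((hmiss huw).1 v)
    · exact h.inj u v w b (by simpa [huv] using hu) (by simpa [huw] using hw)
  · by_cases huv : s(u, v) = s(x, y)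
    · obtain rfl : a = b := by simpa [huv] using hu
      exact (hmiss huv).2
    · exact h.avoid u v b (by simpa [huv] using hu)

theorem missing_update_none (h : IsPartialEdgeColoring G c φ) (hb : φ s(x, b) = some a) :
    Missing c (Function.update φ s(x, b) none) x a := by
  refine ⟨fun w hw => ?_, h.avoid _ _ _ hb⟩
  by_cases hwb : w = b
  · simp [hwb] at hw
  · rw [Function.update_of_ne (Sym2.congr_right.not.2 hwb)] at hw
    exact hwb (h.inj x w b a hw hb)

theorem swapOn (h : IsPartialEdgeColoring G c φ)
    (hC : ∀ u ∈ C, ∀ v, φ s(u, v) = some α ∨ φ s(u, v) = some β → v ∈ C)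
    (hc : ∀ u ∈ C, c u ≠ some α ∧ c u ≠ some β) :
    IsPartialEdgeColoring G c (swapOn C α β φ) := by
  have key : ∀ u, ∃ σ : K → K, (∀ v a, TotalColoring.swapOn C α β φ s(u, v) = some a ↔
      φ s(u, v) = some (σ a)) ∧ ∀ a, c u ≠ some (σ a) → c u ≠ some a := by
    intro u
    by_cases hu : u ∈ C
    · refine ⟨Equiv.swap α β, fun v a => swapOn_of_mem hu, fun a ha => ?_⟩
      by_cases haα : a = α
      · exact haα ▸ (hc u hu).1
      by_cases haβ : a = β
      · exact haβ ▸ (hc u hu).2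
      · rwa [Equiv.swap_apply_of_ne_of_ne haα haβ] at ha
    · exact ⟨id, fun v a => by rw [swapOn_of_notMem hC hu, id], fun _ => id⟩
  refine ⟨fun u v a hu => ?_, fun u v w a hu hv => ?_, fun u v a hu => ?_⟩
  all_goals obtain ⟨σ, hσ, hσc⟩ := key u
  · exact h.adj u v _ ((hσ v a).1 hu)
  · exact h.inj u v w _ ((hσ v a).1 hu) ((hσ w a).1 hv)
  · exact hσc a (h.avoid u v _ ((hσ v a).1 hu))

end IsPartialEdgeColoring

/-- The graph formed by the edges of color `α` or `β`; its components are paths and cycles. -/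
def bicolored (φ : Sym2 V → Option K) (α β : K) : SimpleGraph V :=
  fromRel fun u v => φ s(u, v) = some α ∨ φ s(u, v) = some β

/-- The graph of the edges of color `α` or `β` that avoid `x`. Unlike `bicolored`, it is not
affected by shifts of the fan at `x`. -/
abbrev bicoloredAvoiding (φ : Sym2 V → Option K) (α β : K) (x : V) : SimpleGraph V :=
  (bicolored φ α β).deleteIncidenceSet x

theorem IsPartialEdgeColoring.bicolored_adj {u : V} (h : IsPartialEdgeColoring G c φ) :
    (bicolored φ α β).Adj u v ↔ φ s(u, v) = some α ∨ φ s(u, v) = some β := by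
  rw [bicolored, fromRel_adj, Sym2.eq_swap, or_self, and_iff_right_iff_imp]
  rintro (h' | h') <;> exact (h.adj _ _ _ h').ne'

theorem IsPartialEdgeColoring.card_color_le [Fintype V] (h : IsPartialEdgeColoring G c φ) (v : V)
    (a : K) : #{w | φ s(v, w) = some a} ≤ 1 :=
  card_le_one.2 fun u hu w hw => h.inj v u w a (mem_filter.1 hu).2 (mem_filter.1 hw).2

theorem IsPartialEdgeColoring.card_adj_le_two [Fintype V] {H : SimpleGraph V}
    (h : IsPartialEdgeColoring G c φ) (hH : H ≤ bicolored φ α β) (v : V) :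
    #{w | H.Adj v w} ≤ 2 := by
  refine (card_le_card (monotone_filter_right _ fun w _ hw => h.bicolored_adj.1 (hH hw))).trans ?_
  rw [filter_or]
  exact (card_union_le _ _).trans (Nat.add_le_add (h.card_color_le v α) (h.card_color_le v β))

theorem IsPartialEdgeColoring.card_adj_le_one [Fintype V] {H : SimpleGraph V}
    (h : IsPartialEdgeColoring G c φ) (hH : H ≤ bicolored φ α β) {γ : K} (hγ : γ = α ∨ γ = β)
    (hv : ∀ w, H.Adj v w → φ s(v, w) ≠ some γ) : #{w | H.Adj v w} ≤ 1 := by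
  have hadj : ∀ w, H.Adj v w → φ s(v, w) = some α ∨ φ s(v, w) = some β :=
    fun w hw => h.bicolored_adj.1 (hH hw)
  rcases hγ with rfl | rfl
  · exact (card_le_card (monotone_filter_right _ fun w _ hw =>
      (hadj w hw).resolve_left (hv w hw))).trans (h.card_color_le v β)
  · exact (card_le_card (monotone_filter_right _ fun w _ hw =>
      (hadj w hw).resolve_right (hv w hw))).trans (h.card_color_le v α)

theorem IsPartialEdgeColoring.card_le_card_of_reachable_color [Fintype V] {S : Finset V}
    (h : IsPartialEdgeColoring G c φ) (hS : ∀ v ∈ S, Missing c φ v α)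
    (hr : ∀ v ∈ S, ∃ w, c w = some α ∧ (bicolored φ α β).Reachable v w) :
    #S ≤ #{v | c v = some α} := by
  refine card_le_card_of_reachable_ends (h.card_adj_le_two le_rfl)
    (fun v hv => h.card_adj_le_one le_rfl (.inl rfl) fun w _ => (hS v hv).1 w)
    (fun v hv => h.card_adj_le_one le_rfl (.inl rfl) fun w _ hw => ?_)
    (fun v hv hvα => absurd (mem_filter.1 hvα).2 (hS v hv).2) (by simpa using hr)
  exact h.avoid _ _ _ hw (mem_filter.1 hv).2

theorem IsPartialEdgeColoring.card_le_card_of_reachable_neighbor [Fintype V] {S : Finset V} {γ : K}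
    (h : IsPartialEdgeColoring G c φ) (hγ : γ = α ∨ γ = β) (hS : ∀ v ∈ S, Missing c φ v α)
    (hr : ∀ v ∈ S, ∃ z, φ s(x, z) = some γ ∧ (bicoloredAvoiding φ α β x).Reachable v z) :
    #S ≤ #{z | φ s(x, z) = some γ} := by
  have hle : bicoloredAvoiding φ α β x ≤ bicolored φ α β := deleteIncidenceSet_le _ _
  have havoid : ∀ z, φ s(x, z) = some γ → ∀ w, (bicoloredAvoiding φ α β x).Adj z w →
      φ s(z, w) ≠ some γ := by
    intro z hz w hzw hw
    rw [Sym2.eq_swap] at hz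
    exact (deleteIncidenceSet_adj.1 hzw).2.2 (h.inj _ _ _ _ hw hz)
  refine card_le_card_of_reachable_ends (h.card_adj_le_two hle)
    (fun v hv => h.card_adj_le_one hle (.inl rfl) fun w _ => (hS v hv).1 w)
    (fun z hz => h.card_adj_le_one hle hγ (havoid z (mem_filter.1 hz).2))
    (fun v hv hvγ w hw => ?_) (by simpa using hr)
  have hxv : φ s(x, v) = some γ := (mem_filter.1 hvγ).2
  have hvw : φ s(v, w) = some β := (h.bicolored_adj.1 (hle hw)).resolve_left ((hS v hv).1 w)
  rcases hγ with rfl | rfl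
  · exact (hS v hv).1 x (Sym2.eq_swap ▸ hxv)
  · exact havoid v hxv w hw hvw

variable [Fintype V]

theorem coloredCount_update {e : Sym2 V} (he : φ e = none) (a : K) :
    coloredCount (Function.update φ e (some a)) = coloredCount φ + 1 := by
  have : ({e' | (Function.update φ e (some a) e').isSome} : Finset (Sym2 V)) =
      insert e ({e' | (φ e').isSome} : Finset (Sym2 V)) := by
    ext e'
    by_cases h : e' = e <;> simp [h]
  rw [coloredCount, this, card_insert_of_notMem (by simp [he]), coloredCount]

namespace IsMaxUncolored

theorem symm (h : IsMaxUncolored G c φ x y) : IsMaxUncolored G c φ y x :=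
  ⟨h.isPartial, h.max, h.adj.symm, Sym2.eq_swap ▸ h.uncolored⟩

theorem not_missing_both (h : IsMaxUncolored G c φ x y) (hx : Missing c φ x a) :
    ¬ Missing c φ y a := by
  intro hy
  have := h.max _ (h.isPartial.update_some h.adj hx hy)
  rw [coloredCount_update h.uncolored] at this
  omega

theorem shift (h : IsMaxUncolored G c φ x y) (hy : Missing c φ y a) (hb : φ s(x, b) = some a) :
    IsMaxUncolored G c
      (Function.update (Function.update φ s(x, b) none) s(x, y) (some a)) x b := by
  have hby : b ≠ y := by
    rintro rfl
    simp [h.uncolored] at hb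
  have hnone := h.isPartial.update_none s(x, b)
  have hy' : Missing c (Function.update φ s(x, b) none) y a := by
    refine ⟨fun w hw => hy.1 w ?_, hy.2⟩
    by_cases hyw : s(y, w) = s(x, b)
    · simp [hyw] at hw
    · simpa [hyw] using hw
  have hne : s(x, b) ≠ s(x, y) := Sym2.congr_right.not.2 hby
  have hxy : Function.update φ s(x, b) none s(x, y) = none := by
    rw [Function.update_of_ne hne.symm, h.uncolored]
  refine ⟨hnone.update_some h.adj (h.isPartial.missing_update_none hb) hy', fun χ hχ => ?_,
    h.isPartial.adj _ _ _ hb, by simp [hne]⟩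
  have hcount := coloredCount_update (Function.update_self s(x, b) none φ) a
  rw [Function.update_idem, ← hb, Function.update_eq_self] at hcount
  rw [coloredCount_update hxy, ← hcount]
  exact h.max χ hχ

theorem swapOn (h : IsMaxUncolored G c φ x y)
    (hC : ∀ u ∈ C, ∀ v, φ s(u, v) = some α ∨ φ s(u, v) = some β → v ∈ C)
    (hc : ∀ u ∈ C, c u ≠ some α ∧ c u ≠ some β) :
    IsMaxUncolored G c (swapOn C α β φ) x y := by
  refine ⟨h.isPartial.swapOn hC hc, fun χ hχ => coloredCount_swapOn C α β φ ▸ h.max χ hχ, h.adj, ?_⟩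
  rw [TotalColoring.swapOn, h.uncolored, Option.map_none, ite_self]

end IsMaxUncolored

/-- The steps of a Vizing fan at `x`: the edge `xb` has a color that is missing at `a`. -/
def FanRel (c : V → Option K) (φ : Sym2 V → Option K) (x a b : V) : Prop :=
  ∃ γ, Missing c φ a γ ∧ φ s(x, b) = some γ

/-- The vertices `b` of the Vizing fan at `x` that starts with the edge `xy`: the uncolored edge can
be moved from `xy` to any `xb`. -/
noncomputable def fan (c : V → Option K) (φ : Sym2 V → Option K) (x y : V) : Finset V :=
  {b | ReflTransGen (FanRel c φ x) y b}

theorem mem_fan : b ∈ fan c φ x y ↔ ReflTransGen (FanRel c φ x) y b := by simp [fan]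

/-- `ψ` arises from `φ` by moving the uncolored edge from `xy` to `xb` along a chain of the fan that
visits `T`. By `exists_moved`, a color used on an edge from `x` to `T` moves to the last edge `xp`
at whose end `p` it was missing. -/
structure IsShift (G : SimpleGraph V) (c : V → Option K) (φ : Sym2 V → Option K) (x y : V)
    (T : Set V) (b : V) (ψ : Sym2 V → Option K) : Prop where
  isMax : IsMaxUncolored G c ψ x b
  eq_of_notMem : ∀ e, x ∉ e → ψ e = φ e
  eq_some_iff : ∀ a, (∀ v ∈ T, φ s(x, v) ≠ some a) →
    ∀ v, ψ s(x, v) = some a ↔ φ s(x, v) = some a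
  exists_moved : ∀ a, ∀ v ∈ T, φ s(x, v) = some a → ∃ p T', SimpleChain (FanRel c φ x) y T' p ∧
    (∀ v ∈ T', φ s(x, v) ≠ some a) ∧ Missing c φ p a ∧ ψ s(x, p) = some a

namespace IsShift

theorem missing_end (h : IsShift G c φ x y T b ψ) (ha : Missing c φ b a) : Missing c ψ b a := by
  refine ⟨fun w hw => ?_, ha.2⟩
  by_cases hwx : w = x
  · rw [hwx, Sym2.eq_swap, h.isMax.uncolored] at hw
    simp at hw
  · rw [h.eq_of_notMem _ (by simp [h.isMax.adj.ne, Ne.symm hwx])] at hw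
    exact ha.1 w hw

theorem missing_center (h : IsShift G c φ x y T b ψ) (ha : Missing c φ x a) : Missing c ψ x a :=
  ⟨fun w hw => ha.1 w ((h.eq_some_iff a (fun v _ => ha.1 v) w).1 hw), ha.2⟩

theorem snoc {γ : K} {d : V} (hφ : IsPartialEdgeColoring G c φ) (h : IsShift G c φ x y T p ψ)
    (hT : SimpleChain (FanRel c φ x) y T p) (hp : Missing c φ p γ) (hd : φ s(x, d) = some γ)
    (hdT : d ∉ T) : IsShift G c φ x y (insert d T) d
      (Function.update (Function.update ψ s(x, d) none) s(x, p) (some γ)) := by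
  have hγT : ∀ v ∈ T, φ s(x, v) ≠ some γ := fun v hv hvγ =>
    hdT (hφ.inj x v d γ hvγ hd ▸ hv)
  have hψd : ψ s(x, d) = some γ := (h.eq_some_iff γ hγT d).2 hd
  have hcol : ∀ a, a ≠ γ → ∀ v, Function.update (Function.update ψ s(x, d) none) s(x, p) (some γ)
      s(x, v) = some a ↔ ψ s(x, v) = some a := by
    intro a ha v
    by_cases hvp : v = p
    · simp [hvp, h.isMax.uncolored, ha.symm]
    rw [Function.update_of_ne (Sym2.congr_right.not.2 hvp)]
    by_cases hvd : v = d
    · simp [hvd, hψd, ha.symm]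
    · rw [Function.update_of_ne (Sym2.congr_right.not.2 hvd)]
  refine ⟨h.isMax.shift (h.missing_end hp) hψd, fun e he => ?_, fun a ha v => ?_,
    fun a v hv hva => ?_⟩
  · have hne : ∀ v, e ≠ s(x, v) := by
      rintro v rfl
      exact he (Sym2.mem_mk_left x v)
    rw [Function.update_of_ne (hne p), Function.update_of_ne (hne d), h.eq_of_notMem e he]
  · have haγ : a ≠ γ := by
      rintro rfl
      exact ha d (Set.mem_insert d T) hd
    rw [hcol a haγ, h.eq_some_iff a fun v hv => ha v (Set.mem_insert_of_mem d hv)]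
  · rcases hv with rfl | hv
    · obtain rfl : a = γ := Option.some_injective _ (hva ▸ hd)
      exact ⟨p, T, hT, hγT, hp, Function.update_self _ _ _⟩
    · have haγ : a ≠ γ := by
        rintro rfl
        exact hγT v hv hva
      obtain ⟨p', T', hT', haT', hp', hψp'⟩ := h.exists_moved a v hv hva
      exact ⟨p', T', hT', haT', hp', (hcol a haγ p').2 hψp'⟩

end IsShift

namespace IsMaxUncolored

theorem exists_isShift (h : IsMaxUncolored G c φ x y) (hT : SimpleChain (FanRel c φ x) y T b) :
    ∃ ψ, IsShift G c φ x y T b ψ := by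
  induction hT with
  | single =>
    refine ⟨φ, h, fun _ _ => rfl, fun _ _ _ => Iff.rfl, ?_⟩
    rintro a v rfl hv
    simp [h.uncolored] at hv
  | snoc hT hr hd ih =>
    obtain ⟨ψ, hψ⟩ := ih
    obtain ⟨γ, hpγ, hdγ⟩ := hr
    exact ⟨_, hψ.snoc h.isPartial hT hpγ hdγ hd⟩

theorem adj_of_mem_fan (h : IsMaxUncolored G c φ x y) (hb : b ∈ fan c φ x y) : G.Adj x b := by
  rcases (mem_fan.1 hb).cases_tail with rfl | ⟨_, -, γ, -, hγ⟩
  · exact h.adj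
  · exact h.isPartial.adj _ _ _ hγ

theorem not_missing_of_mem_fan (h : IsMaxUncolored G c φ x y) (hb : b ∈ fan c φ x y)
    (ha : Missing c φ b a) : ¬ Missing c φ x a := by
  obtain ⟨T, hT⟩ := SimpleChain.of_reflTransGen (mem_fan.1 hb)
  obtain ⟨ψ, hψ⟩ := h.exists_isShift hT
  exact fun hx => hψ.isMax.not_missing_both (hψ.missing_center hx) (hψ.missing_end ha)

end IsMaxUncolored

theorem IsShift.bicoloredAvoiding_eq (h : IsMaxUncolored G c φ x y) (hψ : IsShift G c φ x y T b ψ) :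
    bicoloredAvoiding ψ α β x = bicoloredAvoiding φ α β x := by
  ext u v
  simp only [deleteIncidenceSet_adj, hψ.isMax.isPartial.bicolored_adj, h.isPartial.bicolored_adj]
  refine and_congr_left fun ⟨hu, hv⟩ => ?_
  rw [hψ.eq_of_notMem s(u, v) (by simp [hu.symm, hv.symm])]

theorem IsShift.bicolored_eq (h : IsMaxUncolored G c φ x y) (hψ : IsShift G c φ x y T b ψ)
    (hα : ∀ v ∈ T, φ s(x, v) ≠ some α) (hβ : ∀ v ∈ T, φ s(x, v) ≠ some β) :
    bicolored ψ α β = bicolored φ α β := by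
  ext u v
  rw [hψ.isMax.isPartial.bicolored_adj, h.isPartial.bicolored_adj]
  by_cases hu : u = x
  · rw [hu, hψ.eq_some_iff α hα, hψ.eq_some_iff β hβ]
  by_cases hv : v = x
  · rw [hv, Sym2.eq_swap, hψ.eq_some_iff α hα, hψ.eq_some_iff β hβ]
  · rw [hψ.eq_of_notMem s(u, v) (by simp [Ne.symm hu, Ne.symm hv])]

namespace IsMaxUncolored

theorem swapOn_reachable (h : IsMaxUncolored G c φ x y) (hβ : ∀ v, c v ≠ some β)
    (hc : ∀ w, (bicolored φ α β).Reachable y w → c w ≠ some α) :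
    IsMaxUncolored G c (TotalColoring.swapOn {w | (bicolored φ α β).Reachable y w} α β φ) x y :=
  h.swapOn (fun _ hu _ hv => hu.trans (h.isPartial.bicolored_adj.2 hv).reachable)
    fun u hu => ⟨hc u hu, hβ u⟩

/-- If the fan vertex `b` is joined to `W` only after shifting the uncolored edge to `xb`, then the
shift has moved the color `α` to some `xp`; a shift to `p` leaves the two-colored graph unchanged,
so `p` is joined to `W` in the original coloring. -/
theorem reachable_of_forall_shift {W : Set V} (h : IsMaxUncolored G c φ x y)
    (hβ : ∀ p ∈ fan c φ x y, φ s(x, p) ≠ some β)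
    (hW : ∀ T b ψ, IsShift G c φ x y T b ψ → Missing c ψ b α →
      ∃ w ∈ W, (bicolored ψ α β).Reachable b w)
    (hb : b ∈ fan c φ x y) (hα : Missing c φ b α) :
    (∃ w ∈ W, (bicolored φ α β).Reachable b w) ∨
      ∃ z, φ s(x, z) = some β ∧ (bicoloredAvoiding φ α β x).Reachable b z := by
  have hβT : ∀ {T b}, SimpleChain (FanRel c φ x) y T b → ∀ v ∈ T, φ s(x, v) ≠ some β :=
    fun hT v hv => have ⟨_, hT'⟩ := hT.exists_prefix hv
      hβ v (mem_fan.2 hT'.reflTransGen)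
  have hfree : ∀ {T b}, SimpleChain (FanRel c φ x) y T b → (∀ v ∈ T, φ s(x, v) ≠ some α) →
      Missing c φ b α → ∃ w ∈ W, (bicolored φ α β).Reachable b w := by
    intro T b hT hαT hα
    obtain ⟨ψ, hψ⟩ := h.exists_isShift hT
    rw [← hψ.bicolored_eq h hαT (hβT hT)]
    exact hW T b ψ hψ (hψ.missing_end hα)
  have hle : bicoloredAvoiding φ α β x ≤ bicolored φ α β := deleteIncidenceSet_le _ _
  obtain ⟨T, hT⟩ := SimpleChain.of_reflTransGen (mem_fan.1 hb)
  by_cases hαT : ∀ v ∈ T, φ s(x, v) ≠ some α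
  · exact .inl (hfree hT hαT hα)
  push Not at hαT
  obtain ⟨v, hvT, hv⟩ := hαT
  obtain ⟨ψ, hψ⟩ := h.exists_isShift hT
  obtain ⟨w, hw, hbw⟩ := hW T b ψ hψ (hψ.missing_end hα)
  have havoid : (bicolored ψ α β).deleteIncidenceSet x = _ := hψ.bicoloredAvoiding_eq h
  have hsplit := reachable_deleteIncidenceSet_or hbw hψ.isMax.adj.ne'
  rw [havoid] at hsplit
  rcases hsplit with hbw | ⟨u, hxu, hbu⟩
  · exact .inl ⟨w, hw, hbw.mono hle⟩
  rcases hψ.isMax.isPartial.bicolored_adj.1 hxu with hu | hu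
  · obtain ⟨p, T', hT', hαT', hpα, hψp⟩ := hψ.exists_moved α v hvT hv
    obtain rfl := hψ.isMax.isPartial.inj _ _ _ _ hu hψp
    obtain ⟨w', hw', huw'⟩ := hfree hT' hαT' hpα
    exact .inl ⟨w', hw', (hbu.mono hle).trans huw'⟩
  · exact .inr ⟨u, (hψ.eq_some_iff β (hβT hT) u).1 hu, hbu⟩

end IsMaxUncolored

namespace IsMaxUncolored

/-- If `β` is missing at the center `x` of the fan, then swapping `α` and `β` along the path that
starts at a fan vertex missing `α` frees `β` at both ends of the uncolored edge, unless the path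
reaches `x` or a vertex of color `α`. -/
theorem exists_reachable_of_missing_center (h : IsMaxUncolored G c φ x y) (hβ : ∀ v, c v ≠ some β)
    (hx : Missing c φ x β) (hb : b ∈ fan c φ x y) (hα : Missing c φ b α) :
    (∃ w, c w = some α ∧ (bicolored φ α β).Reachable b w) ∨
      ∃ z, φ s(x, z) = some α ∧ (bicoloredAvoiding φ α β x).Reachable b z := by
  have hshift : ∀ T b ψ, IsShift G c φ x y T b ψ → Missing c ψ b α →
      ∃ w ∈ {w | c w = some α ∨ w = x}, (bicolored ψ α β).Reachable b w := by
    intro T b ψ hψ hα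
    by_contra! hcon
    have hbx : ¬ (bicolored ψ α β).Reachable b x := hcon x (.inr rfl)
    refine (hψ.isMax.swapOn_reachable hβ fun w hw hwα => hcon w (.inl hwα) hw).not_missing_both
      (missing_swapOn_of_notMem ?_ hbx (hψ.missing_center hx))
      (missing_swapOn_of_mem (hβ b) (Reachable.refl b) hα)
    exact fun u hu v hv => hu.trans (hψ.isMax.isPartial.bicolored_adj.2 hv).reachable
  rcases h.reachable_of_forall_shift (fun p _ => hx.1 p) hshift hb hα with
    ⟨w, hw | rfl, hbw⟩ | ⟨z, hz, -⟩
  · exact .inl ⟨w, hw, hbw⟩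
  · rcases reachable_deleteIncidenceSet_or hbw (h.adj_of_mem_fan hb).ne' with hbw | ⟨z, hz, hbz⟩
    · obtain ⟨p⟩ := hbw.symm
      cases p with
      | nil => exact absurd rfl (h.adj_of_mem_fan hb).ne
      | cons hadj _ => exact absurd rfl (deleteIncidenceSet_adj.1 hadj).2.1
    · exact .inr ⟨z, (h.isPartial.bicolored_adj.1 hz).resolve_right (hx.1 z), hbz⟩
  · exact absurd hz (hx.1 z)

/-- In this case, swapping `α` and `β` along the path that starts at a fan vertex missing `α`
frees `β` at an end of the uncolored edge, unless the path reaches a vertex of color `α`. -/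
theorem exists_reachable_of_forall_not_missing (h : IsMaxUncolored G c φ x y)
    (hβ : ∀ v, c v ≠ some β) (hno : ∀ ψ b, IsMaxUncolored G c ψ x b → ¬ Missing c ψ b β)
    (hb : b ∈ fan c φ x y) (hα : Missing c φ b α) :
    (∃ w, c w = some α ∧ (bicolored φ α β).Reachable b w) ∨
      ∃ z, φ s(x, z) = some β ∧ (bicoloredAvoiding φ α β x).Reachable b z := by
  have hfan : ∀ p ∈ fan c φ x y, φ s(x, p) ≠ some β := by
    intro p hp hpβ
    rcases (mem_fan.1 hp).cases_tail with rfl | ⟨q, hq, γ, hqγ, hγ⟩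
    · simp [h.uncolored] at hpβ
    obtain rfl : γ = β := Option.some_injective _ (hγ ▸ hpβ)
    obtain ⟨T, hT⟩ := SimpleChain.of_reflTransGen hq
    obtain ⟨ψ, hψ⟩ := h.exists_isShift hT
    exact hno ψ q hψ.isMax (hψ.missing_end hqγ)
  refine h.reachable_of_forall_shift (W := {w | c w = some α}) hfan (fun T b ψ hψ hα => ?_) hb hα
  by_contra! hcon
  exact hno _ b (hψ.isMax.swapOn_reachable hβ fun w hw hwα => hcon w hwα hw)
    (missing_swapOn_of_mem (hβ b) (Reachable.refl b) hα)

theorem card_missing_fan_le (h : IsMaxUncolored G c φ x y) {r : ℕ} {γ : K}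
    (hV : #{v | c v = some α} ≤ r) (hγ : γ = α ∨ γ = β)
    (hr : ∀ b ∈ fan c φ x y, Missing c φ b α →
      (∃ w, c w = some α ∧ (bicolored φ α β).Reachable b w) ∨
        ∃ z, φ s(x, z) = some γ ∧ (bicoloredAvoiding φ α β x).Reachable b z) :
    #{b ∈ fan c φ x y | Missing c φ b α} ≤ r + 1 := by
  rw [← card_filter_add_card_filter_not (s := {b ∈ fan c φ x y | Missing c φ b α})
    (fun b => ∃ w, c w = some α ∧ (bicolored φ α β).Reachable b w)]
  have hmissing : ∀ {S : Finset V}, S ⊆ {b ∈ fan c φ x y | Missing c φ b α} →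
      ∀ v ∈ S, Missing c φ v α := fun hS v hv => (mem_filter.1 (hS hv)).2
  refine Nat.add_le_add ((h.isPartial.card_le_card_of_reachable_color (hmissing (filter_subset _ _))
    fun v hv => (mem_filter.1 hv).2).trans hV)
    ((h.isPartial.card_le_card_of_reachable_neighbor hγ (hmissing (filter_subset _ _))
      fun v hv => ?_).trans (h.isPartial.card_color_le x γ))
  obtain ⟨hv, hno⟩ := mem_filter.1 hv
  exact (hr v (mem_filter.1 hv).1 (mem_filter.1 hv).2).resolve_left hno

end IsMaxUncolored

variable [Fintype K]

namespace IsMaxUncolored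

theorem card_missing_in_fan_le (h : IsMaxUncolored G c φ x y) :
    #{a | ∃ b ∈ fan c φ x y, Missing c φ b a} ≤ #(fan c φ x y) := by
  have hy : y ∈ fan c φ x y := mem_fan.2 .refl
  have hle := card_le_of_forall_not_missing (c := c) (φ := φ) (v := x) (N := (fan c φ x y).erase y)
    (U := {a | ∃ b ∈ fan c φ x y, Missing c φ b a}) (fun a ha => ?_) fun a ha w hw => ?_
  · have hc : #(c x).toFinset ≤ 1 := by cases c x <;> simp
    have := card_erase_add_one hy
    omega
  · obtain ⟨-, b, hb, hba⟩ := mem_filter.1 ha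
    exact h.not_missing_of_mem_fan hb hba
  · obtain ⟨-, b, hb, hba⟩ := mem_filter.1 ha
    refine mem_erase.2 ⟨?_, mem_fan.2 ((mem_fan.1 hb).tail ⟨a, hba, hw⟩)⟩
    rintro rfl
    simp [h.uncolored] at hw

theorem le_card_missing (h : IsMaxUncolored G c φ x y) {m : ℕ}
    (hdeg : #{w | G.Adj v w} + #(c v).toFinset + m ≤ Fintype.card K) :
    m + (if v = y then 1 else 0) ≤ #{a | Missing c φ v a} := by
  have hadj : ∀ w a, φ s(v, w) = some a → w ∈ ({w | G.Adj v w} : Finset V) :=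
    fun w a hw => by simpa using h.isPartial.adj _ _ _ hw
  split_ifs with hvy
  · subst hvy
    have hx : x ∈ ({w | G.Adj v w} : Finset V) := by simpa using h.adj.symm
    have hN : ∀ w a, φ s(v, w) = some a → w ∈ ({w | G.Adj v w} : Finset V).erase x := by
      refine fun w a hw => mem_erase.2 ⟨?_, hadj w a hw⟩
      rintro rfl
      simp [h.symm.uncolored] at hw
    have := card_univ_le_card_missing_add (c := c) hN
    have := card_erase_add_one hx
    omega
  · have := card_univ_le_card_missing_add (c := c) hadj
    omega

/-- Count the pairs of a fan vertex and a color missing at it: there are at most as many colors as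
fan vertices, and `y` misses one color more than the others because `xy` is uncolored. -/
theorem exists_lt_card_missing_fan (h : IsMaxUncolored G c φ x y) {m : ℕ}
    (hdeg : ∀ v, #{w | G.Adj v w} + #(c v).toFinset + m ≤ Fintype.card K) :
    ∃ a, m < #{b ∈ fan c φ x y | Missing c φ b a} := by
  by_contra! hle
  set F := fan c φ x y
  set U : Finset K := {a | ∃ b ∈ F, Missing c φ b a}
  have hyF : y ∈ F := mem_fan.2 .refl
  have hlower : ∀ b ∈ F, m + (if b = y then 1 else 0) ≤ #{a ∈ U | Missing c φ b a} := by
    intro b hb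
    refine (h.le_card_missing (hdeg b)).trans (card_le_card fun a ha => ?_)
    have hba := (mem_filter.1 ha).2
    exact mem_filter.2 ⟨mem_filter.2 ⟨mem_univ a, b, hb, hba⟩, hba⟩
  have hcount : #F * m + 1 ≤ #F * m :=
    calc
      #F * m + 1 = ∑ b ∈ F, (m + if b = y then 1 else 0) := by
        rw [sum_add_distrib, sum_const, sum_ite_eq' F y, if_pos hyF, smul_eq_mul]
      _ ≤ ∑ b ∈ F, #{a ∈ U | Missing c φ b a} := sum_le_sum hlower
      _ = ∑ a ∈ U, #{b ∈ F | Missing c φ b a} :=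
        sum_card_bipartiteAbove_eq_sum_card_bipartiteBelow (Missing c φ)
      _ ≤ #U * m := sum_le_card_nsmul _ _ _ fun a _ => hle a
      _ ≤ #F * m := Nat.mul_le_mul_right m h.card_missing_in_fan_le
  omega

end IsMaxUncolored

theorem exists_edge_coloring (G : SimpleGraph V) (c : V → Option K) {r : ℕ}
    (hV : ∀ a, #{v | c v = some a} ≤ r) (hβ : ∀ v, c v ≠ some β)
    (hdeg : ∀ v, #{w | G.Adj v w} + #(c v).toFinset + (r + 1) ≤ Fintype.card K) :
    ∃ φ, IsPartialEdgeColoring G c φ ∧ ∀ u v, G.Adj u v → φ s(u, v) ≠ none := by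
  obtain ⟨φ, hφ, hmax⟩ := exists_max_image
    (univ.filter fun φ : Sym2 V → Option K => IsPartialEdgeColoring G c φ) coloredCount
    ⟨fun _ => none, mem_filter.2 ⟨mem_univ _, by constructor <;> simp⟩⟩
  refine ⟨φ, (mem_filter.1 hφ).2, fun x y hxy hnone => ?_⟩
  have h : IsMaxUncolored G c φ x y := ⟨(mem_filter.1 hφ).2,
    fun ψ hψ => hmax ψ (mem_filter.2 ⟨mem_univ _, hψ⟩), hxy, hnone⟩
  have hcenter : ∀ {ψ x y}, IsMaxUncolored G c ψ x y → ¬ Missing c ψ x β := by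
    intro ψ x y h hx
    obtain ⟨α, hα⟩ := h.exists_lt_card_missing_fan hdeg
    exact hα.not_ge (h.card_missing_fan_le (hV α) (.inl rfl) fun b =>
      h.exists_reachable_of_missing_center hβ hx)
  obtain ⟨α, hα⟩ := h.exists_lt_card_missing_fan hdeg
  exact hα.not_ge (h.card_missing_fan_le (hV α) (.inr rfl) fun b =>
    h.exists_reachable_of_forall_not_missing hβ fun ψ b hψ => hcenter hψ.symm)

end EdgeColoring

section TotalColorable

variable {V : Type*} {G : SimpleGraph V}

theorem totalColorable_mono {k l : ℕ} (h : G.TotalColorable k) (hkl : k ≤ l) :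
    G.TotalColorable l := by
  obtain ⟨c, hc⟩ := h
  have hinj := Fin.castLE_injective hkl
  exact ⟨fun x => Fin.castLE hkl (c x), fun u v huv h => hc.vertex_ne u v huv (hinj h),
    fun e f hef hv h => hc.edge_ne e f hef hv (hinj h),
    fun v e hv h => hc.incident_ne v e hv (hinj h)⟩

theorem totalColorable_of_isPartialEdgeColoring {k : ℕ} {c : V → Fin k}
    {φ : Sym2 V → Option (Fin k)} (hc : ∀ u v, G.Adj u v → c u ≠ c v)
    (hφ : IsPartialEdgeColoring G (fun v => some (c v)) φ)
    (hfull : ∀ u v, G.Adj u v → φ s(u, v) ≠ none) : G.TotalColorable k := by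
  have hex : ∀ e : G.edgeSet, ∃ a, φ e = some a := by
    rintro ⟨e, he⟩
    induction e with | _ u v
    exact Option.ne_none_iff_exists'.1 (hfull u v he)
  choose col hcol using hex
  refine ⟨Sum.elim c col, hc, ?_, ?_⟩
  · rintro e f hef ⟨v, ⟨u, hu⟩, ⟨w, hw⟩⟩ (h : col e = col f)
    have huw : u = w := hφ.inj v u w (col e) (hu ▸ hcol e) (by rw [h, ← hw, hcol])
    exact hef (Subtype.ext (by rw [hu, hw, huw]))
  · rintro v e ⟨u, hu⟩ (h : c v = col e)
    exact hφ.avoid v u (col e) (hu ▸ hcol e) (congrArg some h)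

/-- Color the edges of the complete graph on `Option V`; every vertex `v` gets the color of the edge
that joins it to the additional vertex `none`. -/
theorem totalColorable_card_add_one [Fintype V] (G : SimpleGraph V) :
    G.TotalColorable (Fintype.card V + 1) := by
  have hdeg : ∀ v : Option V, #{w | v ≠ w} ≤ Fintype.card V := by
    intro v
    rw [filter_ne, card_erase_of_mem (mem_univ v), card_univ, Fintype.card_option,
      Nat.add_sub_cancel]
  obtain ⟨φ, hφ, hfull⟩ := exists_edge_coloring (K := Fin (Fintype.card V + 1)) (β := 0) (r := 0)
    (⊤ : SimpleGraph (Option V)) (fun _ => none) (by simp) (by simp) fun v => by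
      simpa using hdeg v
  have hex : ∀ v, ∃ a, φ s(none, some v) = some a := fun v =>
    Option.ne_none_iff_exists'.1 (hfull none (some v) (by simp))
  choose c hc using hex
  have hmap : ∀ {u v a}, (if s(u, v) ∈ G.edgeSet then φ s(some u, some v) else none) = some a →
      G.Adj u v ∧ φ s(some u, some v) = some a := by simp
  refine totalColorable_of_isPartialEdgeColoring (c := c) (φ := fun e =>
    if e ∈ G.edgeSet then φ (e.map some) else none) (fun u v huv h => ?_)
    ⟨fun u v a h => (hmap h).1, fun u v w a hv hw => ?_, fun u v a hv h => ?_⟩ fun u v huv => ?_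
  · exact huv.ne (Option.some_injective _ (hφ.inj none _ _ _ (hc u) (h ▸ hc v)))
  · exact Option.some_injective _ (hφ.inj _ _ _ a (hmap hv).2 (hmap hw).2)
  · have hu : φ s(some u, none) = some a := by rw [Sym2.eq_swap, hc, h]
    exact Option.some_ne_none v (hφ.inj _ _ _ a (hmap hv).2 hu)
  · simpa [huv] using hfull (some u) (some v) (by simpa using huv.ne)

theorem totalColorable_of_coloring [Fintype V] {k l r : ℕ} (hkl : k < l) {f : V → Fin k}
    (hf : ∀ u v, G.Adj u v → f u ≠ f v) (hr : ∀ a, #{v | f v = a} ≤ r)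
    (hdeg : ∀ v, #{w | G.Adj v w} + r + 2 ≤ l) : G.TotalColorable l := by
  have hinj := Fin.castLE_injective hkl.le
  have hclass : ∀ a, #{v | Fin.castLE hkl.le (f v) = a} ≤ r := by
    intro a
    by_cases ha : ∃ b, Fin.castLE hkl.le b = a
    · obtain ⟨b, rfl⟩ := ha
      simpa [hinj.eq_iff] using hr b
    · push Not at ha
      simp [ha]
  have hunused : ∀ v, some (Fin.castLE hkl.le (f v)) ≠ some ⟨k, hkl⟩ := fun v h =>
    (f v).2.ne (congrArg Fin.val (Option.some_injective _ h))
  obtain ⟨φ, hφ, hfull⟩ := exists_edge_coloring (r := r) G _ (by simpa using hclass) hunused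
    fun v => by
      have := hdeg v
      simp only [Option.toFinset_some, card_singleton, Fintype.card_fin]
      omega
  exact totalColorable_of_isPartialEdgeColoring (fun u v huv h => hf u v huv (hinj h)) hφ hfull

theorem totalColorable_of_card_le_mul [Fintype V] (G : SimpleGraph V) {d r : ℕ}
    (hdeg : ∀ v, #{w | G.Adj v w} ≤ d) (hcard : Fintype.card V ≤ r * (d + 1)) :
    G.TotalColorable (d + 2 * r) := by
  rcases le_or_gt 2 r with hr | hr
  · obtain ⟨f, hf, hfr⟩ :=
      exists_coloring_card_le (k := d + 1) (fun v => Nat.lt_succ_of_le (hdeg v)) hcard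
    exact totalColorable_of_coloring (by omega) hf hfr fun v => by have := hdeg v; omega
  rcases Nat.le_one_iff_eq_zero_or_eq_one.1 (Nat.le_of_lt_succ hr) with rfl | rfl
  · have : IsEmpty V := Fintype.card_eq_zero_iff.1 (by omega)
    have : IsEmpty G.edgeSet := by
      refine ⟨fun ⟨e, _⟩ => ?_⟩
      induction e with | _ u v
      exact isEmptyElim u
    exact ⟨isEmptyElim, fun u => isEmptyElim u, fun e => isEmptyElim e, fun u => isEmptyElim u⟩
  · exact totalColorable_mono (totalColorable_card_add_one G) (by omega)

end TotalColorable

end TotalColoring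

theorem theorem1 {V : Type*} [Fintype V] (G : SimpleGraph V) [DecidableRel G.Adj] :
    G.totalChromaticNumber ≤
        ((G.maxDegree + 2 * ⌈(Fintype.card V : ℚ) / ((G.maxDegree : ℚ) + 1)⌉₊ : ℕ) : ℕ∞) ∧
      (0 < G.maxDegree →
        G.maxDegree + 2 * ⌈(Fintype.card V : ℚ) / ((G.maxDegree : ℚ) + 1)⌉₊ + 1 ≤
          G.maxDegree + 2 * ⌈(Fintype.card V : ℚ) / (G.maxDegree : ℚ)⌉₊ + 1) ∧
      ((Fintype.card V : ℚ) / 2 ≤ (G.maxDegree : ℚ) → G.TotalColorable (G.maxDegree + 4)) := by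
  have hpos : (0 : ℚ) < (G.maxDegree : ℚ) + 1 := by positivity
  have hcol : G.TotalColorable
      (G.maxDegree + 2 * ⌈(Fintype.card V : ℚ) / ((G.maxDegree : ℚ) + 1)⌉₊) := by
    refine TotalColoring.totalColorable_of_card_le_mul G (fun v => ?_) ?_
    · convert G.degree_le_maxDegree v
      rw [← SimpleGraph.card_neighborFinset_eq_degree, SimpleGraph.neighborFinset_eq_filter]
      congr!
    · exact_mod_cast (div_le_iff₀ hpos).1
        (Nat.le_ceil ((Fintype.card V : ℚ) / ((G.maxDegree : ℚ) + 1)))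
  refine ⟨iInf₂_le _ hcol, fun h => ?_, fun h => TotalColoring.totalColorable_mono hcol ?_⟩
  · have : (0 : ℚ) < G.maxDegree := by exact_mod_cast h
    gcongr
    linarith
  · have : ⌈(Fintype.card V : ℚ) / ((G.maxDegree : ℚ) + 1)⌉₊ ≤ 2 := by
      rw [Nat.ceil_le, div_le_iff₀ hpos]
      push_cast
      linarith
    omega
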